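/- Let $V$ be a dagger compact category with chosen duals $A^*$, units $\eta_A\colon I\to A^*\otimes A$ and counits $\varepsilon_A\colon A\otimes A^*\to I$, and suppose that $V$ has dagger biproducts (a zero object, and for any two objects a biproduct whose projections are the daggers of its injections). Addition of morphisms is the one induced by biproducts. *Complete positivity.* A morphism $f\colon A^*\otimes A\to B^*\otimes B$ is completely positive if, for some object $C$ and some $g\colon A\to C\otimes B$, it is obtained from $g_*\otimes g\colon A^*\otimes A\to (B^*\otimes C^*)\otimes(C\otimes B)$ by connecting the wires $C^*$ and $C$ with $\eta_C^\dagger$; here $g_*=(g^*)^\dagger$ is the conjugate of $g$. The category $\mathrm{CPM}[V]$ has the objects of $V$; its morphisms $A\to B$ are the completely positive morphisms $A^*\otimes A\to B^*\otimes B$, composed as in $V$. *Normalisable dagger Frobenius algebras.* A dagger Frobenius algebra is a monoid $(A,m,u)$ in $V$ with $(m\otimes 1)(1\otimes m^\dagger)=m^\dagger m=(1\otimes m)(m^\dagger\otimes 1)$. Its action is $a_A=(\mathrm{id}_{A^*}\otimes m)\circ(\eta_A\otimes\mathrm{id}_A)\colon A\to A^*\otimes A$. A normaliser is an isomorphism $z\colon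 A\to A$ which is positive ($z=h^\dagger h$ for some $h$), central ($m(z\otimes 1)=zm=m(1\otimes z)$) and satisfies $\eta_A^\dagger\circ a_A\circ z\circ z=u^\dagger$. The category $\mathrm{CP}^*[V]$ has as objects the dagger Frobenius algebras equipped with a normaliser; its morphisms $A\to B$ are the $f\colon A\to B$ in $V$ for which $a_B\circ f\circ a_A^\dagger$ is completely positive. *Embedding.* Assume that, for every object $A$ of $V$, the pair-of-pants dagger Frobenius algebra $A^*\otimes A$ (with multiplication $\mathrm{id}\otimes\varepsilon_A\otimes\mathrm{id}$ and unit $\eta_A$) is normalisable, and let $z_A$ be any choice of normalisers. Let $\mathcal B\colon \mathrm{CPM}[V]\to\mathrm{CP}^*[V]$ be the functor that sends $A$ to $(A^*\otimes A,z_A)$ and is the identity on morphisms. *Completion.* Let $\mathrm{CPM}[V]^\oplus$ be the free biproduct completion of $\mathrm{CPM}[V]$, with its sums of morphisms taken from $V$: objects are finite families of objects, and morphisms are matrices of morphisms. Then $\mathcal B$ is full and faithful, and it extends, up to natural isomorphism, along the canonical inclusion $\mathrm{CPM}[V]\to\mathrm{CPM}[V]^\oplus$ to a full and faithful functor $\mathrm{CPM}[V]^\oplus\to\mathrm{CP}^*[V]$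 that preserves zero morphisms and sums of morphisms. -/

import Mathlib

open CategoryTheory MonoidalCategory Limits ExactPairing

universe v u

set_option linter.unusedSectionVars false

/-- A category with a dagger: an involutive, identity-on-objects contravariant functor. -/
class DaggerCategory (V : Type u) [Category.{v} V] where
  /-- The dagger of a morphism. -/
  dagger : ∀ {X Y : V}, (X ⟶ Y) → (Y ⟶ X)
  dagger_dagger : ∀ {X Y : V} (f : X ⟶ Y), dagger (dagger f) = f
  dagger_id : ∀ X : V, dagger (𝟙 X) = 𝟙 X
  dagger_comp : ∀ {X Y Z : V} (f : X ⟶ Y) (g : Y ⟶ Z), dagger (f ≫ g) = dagger g ≫ dagger f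

/-- A dagger compact category: a compact (symmetric monoidal, with a chosen dual `ᘁA` of every
object `A`, with unit `η_ ᘁA A : 𝟙_ ⟶ ᘁA ⊗ A` and counit `ε_ ᘁA A : A ⊗ ᘁA ⟶ 𝟙_`) category with a
dagger that preserves tensor products of morphisms, for which the coherence isomorphisms are
unitary, and such that the counit is the dagger of the unit, up to symmetry. -/
class DaggerCompactCategory (V : Type u) [Category.{v} V] [MonoidalCategory V]
    [SymmetricCategory V] [LeftRigidCategory V] extends DaggerCategory V where
  dagger_tensor : ∀ {X₁ Y₁ X₂ Y₂ : V} (f : X₁ ⟶ Y₁) (g : X₂ ⟶ Y₂),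
    dagger (f ⊗ₘ g) = dagger f ⊗ₘ dagger g
  dagger_associator : ∀ X Y Z : V, dagger (α_ X Y Z).hom = (α_ X Y Z).inv
  dagger_leftUnitor : ∀ X : V, dagger (λ_ X).hom = (λ_ X).inv
  dagger_rightUnitor : ∀ X : V, dagger (ρ_ X).hom = (ρ_ X).inv
  dagger_braiding : ∀ X Y : V, dagger (β_ X Y).hom = (β_ X Y).inv
  evaluation_eq : ∀ A : V, ε_ (ᘁA : V) A = (β_ A (ᘁA : V)).hom ≫ dagger (η_ (ᘁA : V) A)

namespace CPStarConstruction

open DaggerCategory DaggerCompactCategory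

section Basic

variable {V : Type u} [Category.{v} V] [MonoidalCategory V] [SymmetricCategory V]
  [LeftRigidCategory V] [DaggerCompactCategory V]

/-- The unit `𝟙_ ⟶ ᘁA ⊗ A` of the duality between `A` and its dual. -/
def cup (A : V) : 𝟙_ V ⟶ (ᘁA : V) ⊗ A := η_ (ᘁA : V) A

/-- The counit `A ⊗ ᘁA ⟶ 𝟙_` of the duality between `A` and its dual. -/
def cap (A : V) : A ⊗ (ᘁA : V) ⟶ 𝟙_ V := ε_ (ᘁA : V) A

/-- The dagger `ᘁA ⊗ A ⟶ 𝟙_` of the unit. -/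
def dcap (A : V) : (ᘁA : V) ⊗ A ⟶ 𝟙_ V := dagger (cup A)

/-- The dagger `𝟙_ ⟶ A ⊗ ᘁA` of the counit. -/
def dcup (A : V) : 𝟙_ V ⟶ A ⊗ (ᘁA : V) := dagger (cap A)

/-- The transpose `g^* : B^* ⊗ C^* ⟶ A^*` of `g : A ⟶ C ⊗ B`. -/
def upperStar {A B C : V} (g : A ⟶ C ⊗ B) : (ᘁB : V) ⊗ (ᘁC : V) ⟶ (ᘁA : V) :=
  (λ_ _).inv ≫ cup A ▷ ((ᘁB : V) ⊗ (ᘁC : V)) ≫ (α_ _ _ _).hom ≫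
    (ᘁA : V) ◁ (g ▷ ((ᘁB : V) ⊗ (ᘁC : V)) ≫ (α_ _ _ _).hom ≫
      C ◁ ((α_ _ _ _).inv ≫ cap B ▷ (ᘁC : V) ≫ (λ_ _).hom) ≫ cap C) ≫ (ρ_ _).hom

/-- The conjugate `g_* = (g^*)† : A^* ⟶ B^* ⊗ C^*` of `g : A ⟶ C ⊗ B`. -/
def lowerStar {A B C : V} (g : A ⟶ C ⊗ B) : (ᘁA : V) ⟶ (ᘁB : V) ⊗ (ᘁC : V) :=
  dagger (upperStar g)

/-- The morphism `A^* ⊗ A ⟶ B^* ⊗ B` obtained from `g_* ⊗ g : A^* ⊗ A ⟶ (B^* ⊗ C^*) ⊗ (C ⊗ B)` by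
connecting the two wires `C^*` and `C`. -/
def krausMap {A B C : V} (g : A ⟶ C ⊗ B) : (ᘁA : V) ⊗ A ⟶ (ᘁB : V) ⊗ B :=
  (lowerStar g ⊗ₘ g) ≫ (α_ _ _ _).hom ≫
    (ᘁB : V) ◁ ((α_ _ _ _).inv ≫ dcap C ▷ B ≫ (λ_ _).hom)

/-- Complete positivity of a morphism `A^* ⊗ A ⟶ B^* ⊗ B`. -/
def IsCP {A B : V} (f : (ᘁA : V) ⊗ A ⟶ (ᘁB : V) ⊗ B) : Prop :=
  ∃ (C : V) (g : A ⟶ C ⊗ B), f = krausMap g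

section Dagger

lemma dag_whiskerRight {X Y : V} (f : X ⟶ Y) (Z : V) : dagger (f ▷ Z) = dagger f ▷ Z := by
  rw [← tensorHom_id, dagger_tensor, dagger_id, tensorHom_id]

lemma dag_whiskerLeft {X Y : V} (Z : V) (f : X ⟶ Y) : dagger (Z ◁ f) = Z ◁ dagger f := by
  rw [← id_tensorHom, dagger_tensor, dagger_id, id_tensorHom]

lemma dag_associator_inv (X Y Z : V) : dagger (α_ X Y Z).inv = (α_ X Y Z).hom := by
  rw [← dagger_associator, dagger_dagger]

lemma dag_leftUnitor_inv (X : V) : dagger (λ_ X).inv = (λ_ X).hom := by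
  rw [← dagger_leftUnitor, dagger_dagger]

lemma dag_rightUnitor_inv (X : V) : dagger (ρ_ X).inv = (ρ_ X).hom := by
  rw [← dagger_rightUnitor, dagger_dagger]

lemma dag_cup (A : V) : dagger (cup A) = dcap A := rfl
lemma dag_cap (A : V) : dagger (cap A) = dcup A := rfl
lemma dag_dcap (A : V) : dagger (dcap A) = cup A := dagger_dagger _
lemma dag_dcup (A : V) : dagger (dcup A) = cap A := dagger_dagger _

lemma snake₁ (A : V) : cup A ▷ (ᘁA : V) ≫ (α_ _ _ _).hom ≫ (ᘁA : V) ◁ cap A =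
    (λ_ _).hom ≫ (ρ_ _).inv := evaluation_coevaluation _ _

lemma snake₂ (A : V) : A ◁ cup A ≫ (α_ _ _ _).inv ≫ cap A ▷ A =
    (ρ_ _).hom ≫ (λ_ _).inv := coevaluation_evaluation _ _

lemma snake₃ (A : V) : (ᘁA : V) ◁ dcup A ≫ (α_ _ _ _).inv ≫ dcap A ▷ (ᘁA : V) =
    (ρ_ _).hom ≫ (λ_ _).inv := by
  have h := congrArg dagger (snake₁ A)
  simpa [dagger_comp, dag_whiskerRight, dag_whiskerLeft, dagger_associator, dagger_leftUnitor,
    dag_rightUnitor_inv, dag_cup, dag_cap] using h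

lemma snake₄ (A : V) : dcup A ▷ A ≫ (α_ _ _ _).hom ≫ A ◁ dcap A =
    (λ_ _).hom ≫ (ρ_ _).inv := by
  have h := congrArg dagger (snake₂ A)
  simpa [dagger_comp, dag_whiskerRight, dag_whiskerLeft, dag_associator_inv, dag_leftUnitor_inv,
    dagger_rightUnitor, dag_cup, dag_cap] using h

lemma dcup_eq (A : V) : dcup A = cup A ≫ (β_ _ _).hom := by
  have h := congrArg dagger (evaluation_eq A)
  rw [dagger_comp, dagger_dagger, dagger_braiding] at h
  rw [SymmetricCategory.braiding_swap_eq_inv_braiding]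
  simpa [dcup, cup, cap] using h

lemma dcap_eq (A : V) : dcap A = (β_ _ _).hom ≫ cap A := by
  have h := evaluation_eq A
  change cap A = _ ≫ dcap A at h
  rw [h]; simp

end Dagger

section Choi

/-- Bending the input `A^*` to an output `A`. -/
def choi {A Z : V} (f : (ᘁA : V) ⊗ A ⟶ Z) : A ⟶ A ⊗ Z :=
  (λ_ _).inv ≫ dcup A ▷ A ≫ (α_ _ _ _).hom ≫ A ◁ f

lemma choi_comp {A Z W : V} (f : (ᘁA : V) ⊗ A ⟶ Z) (h : Z ⟶ W) :
    choi (f ≫ h) = choi f ≫ A ◁ h := by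
  simp [choi]

lemma choi_inv {A Z : V} (f : (ᘁA : V) ⊗ A ⟶ Z) :
    (ᘁA : V) ◁ choi f ≫ (α_ _ _ _).inv ≫ dcap A ▷ Z ≫ (λ_ _).hom = f := by
  calc _ = (𝟙 _) ⊗≫ ((ᘁA : V) ◁ dcup A) ▷ A ⊗≫ (((ᘁA : V) ⊗ A) ◁ f ≫ dcap A ▷ Z) ⊗≫ 𝟙 _ := by
        unfold choi; monoidal
    _ = (𝟙 _) ⊗≫ ((ᘁA : V) ◁ dcup A ≫ (α_ _ _ _).inv ≫ dcap A ▷ (ᘁA : V)) ▷ A ⊗≫ f := by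
        rw [whisker_exchange]; monoidal
    _ = _ := by rw [snake₃]; monoidal

lemma choi_injective {A Z : V} {f f' : (ᘁA : V) ⊗ A ⟶ Z} (h : choi f = choi f') : f = f' := by
  rw [← choi_inv f, h, choi_inv]

/-- The bent form of `krausMap g`. -/
def kraus {A B C Z : V} (g : A ⟶ C ⊗ B) (k : B ⟶ B ⊗ Z) : A ⟶ A ⊗ Z :=
  g ≫ C ◁ k ≫ (α_ _ _ _).inv ≫ dagger g ▷ Z

lemma lowerStar_eq {A B C : V} (g : A ⟶ C ⊗ B) :
    lowerStar g = (ρ_ _).inv ≫ (ᘁA : V) ◁ (dcup C ≫ C ◁ ((λ_ _).inv ≫ dcup B ▷ (ᘁC : V) ≫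
      (α_ _ _ _).hom) ≫ (α_ _ _ _).inv ≫ dagger g ▷ ((ᘁB : V) ⊗ (ᘁC : V))) ≫ (α_ _ _ _).inv ≫
      dcap A ▷ ((ᘁB : V) ⊗ (ᘁC : V)) ≫ (λ_ _).hom := by
  simp [lowerStar, upperStar, dagger_comp, dag_whiskerRight, dag_whiskerLeft, dagger_associator,
    dag_associator_inv, dagger_leftUnitor, dag_leftUnitor_inv, dagger_rightUnitor, dag_cup, dag_cap]

lemma choi_krausMap {A B C : V} (g : A ⟶ C ⊗ B) :
    choi (krausMap g) = kraus g (choi (𝟙 _)) := by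
  have e1 : dcup A ▷ A ≫ (α_ _ _ _).hom ≫ A ◁ (lowerStar g ▷ A) =
      (dcup C ≫ C ◁ ((λ_ _).inv ≫ dcup B ▷ (ᘁC : V) ≫
        (α_ _ _ _).hom) ≫ (α_ _ _ _).inv ≫ dagger g ▷ ((ᘁB : V) ⊗ (ᘁC : V))) ▷ A ≫
        (α_ _ _ _).hom := by
    rw [lowerStar_eq]
    generalize (dcup C ≫ C ◁ ((λ_ _).inv ≫ dcup B ▷ (ᘁC : V) ≫
      (α_ _ _ _).hom) ≫ (α_ _ _ _).inv ≫ dagger g ▷ ((ᘁB : V) ⊗ (ᘁC : V))) = k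
    calc _ = (𝟙 _) ⊗≫ (dcup A ▷ (𝟙_ V) ≫ (A ⊗ (ᘁA : V)) ◁ k) ▷ A ⊗≫
          A ◁ (dcap A ▷ ((ᘁB : V) ⊗ (ᘁC : V))) ▷ A ⊗≫ 𝟙 _ := by monoidal
      _ = (𝟙 _) ⊗≫ k ▷ A ⊗≫ (dcup A ▷ A ≫ (α_ _ _ _).hom ≫ A ◁ dcap A) ▷
          (((ᘁB : V) ⊗ (ᘁC : V)) ⊗ A) ⊗≫ 𝟙 _ := by rw [← whisker_exchange]; monoidal
      _ = _ := by rw [snake₄]; monoidal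
  calc _ = (λ_ _).inv ≫ (dcup A ▷ A ≫ (α_ _ _ _).hom ≫ A ◁ (lowerStar g ▷ A)) ⊗≫
        A ◁ ((ᘁB : V) ⊗ (ᘁC : V)) ◁ g ⊗≫ A ◁ (ᘁB : V) ◁ dcap C ▷ B ⊗≫ 𝟙 _ := by
        unfold choi krausMap; rw [MonoidalCategory.tensorHom_def]; monoidal
    _ = (λ_ _).inv ≫ ((dcup C ≫ C ◁ ((λ_ _).inv ≫ dcup B ▷ (ᘁC : V) ≫
        (α_ _ _ _).hom) ≫ (α_ _ _ _).inv ≫ dagger g ▷ ((ᘁB : V) ⊗ (ᘁC : V))) ▷ A ≫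
        ((A ⊗ ((ᘁB : V) ⊗ (ᘁC : V))) ◁ g)) ⊗≫ A ◁ (ᘁB : V) ◁ dcap C ▷ B ⊗≫ 𝟙 _ := by
        rw [e1]; monoidal
    _ = (λ_ _).inv ≫ (𝟙_ V) ◁ g ⊗≫ dcup C ▷ (C ⊗ B) ⊗≫ C ◁ (dcup B ▷ ((ᘁC : V) ⊗ C)) ▷ B ⊗≫
        (dagger g ▷ ((ᘁB : V) ⊗ ((ᘁC : V) ⊗ C)) ≫ A ◁ ((ᘁB : V) ◁ dcap C)) ▷ B ⊗≫ 𝟙 _ := by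
        rw [← whisker_exchange]; monoidal
    _ = (λ_ _).inv ≫ (𝟙_ V) ◁ g ⊗≫ dcup C ▷ (C ⊗ B) ⊗≫ C ◁ (dcup B ▷ ((ᘁC : V) ⊗ C) ≫ (B ⊗ (ᘁB : V)) ◁ dcap C) ▷ B ⊗≫
        dagger g ▷ ((ᘁB : V) ⊗ B) ⊗≫ 𝟙 _ := by
        rw [← whisker_exchange]; monoidal
    _ = (λ_ _).inv ≫ (𝟙_ V) ◁ g ⊗≫ (dcup C ▷ C ≫ (α_ _ _ _).hom ≫ C ◁ dcap C) ▷ B ⊗≫ C ◁ (dcup B ▷ B) ⊗≫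
        dagger g ▷ ((ᘁB : V) ⊗ B) ⊗≫ 𝟙 _ := by
        rw [← whisker_exchange]; monoidal
    _ = _ := by rw [snake₄]; unfold choi kraus; monoidal

lemma isCP_iff {A B : V} (f : (ᘁA : V) ⊗ A ⟶ (ᘁB : V) ⊗ B) :
    IsCP f ↔ ∃ (C : V) (g : A ⟶ C ⊗ B), choi f = kraus g (choi (𝟙 _)) := by
  constructor
  · rintro ⟨C, g, rfl⟩
    exact ⟨C, g, choi_krausMap g⟩
  · rintro ⟨C, g, h⟩
    exact ⟨C, g, choi_injective (h.trans (choi_krausMap g).symm)⟩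

lemma isCP_id (A : V) : IsCP (𝟙 ((ᘁA : V) ⊗ A)) := by
  rw [isCP_iff]
  refine ⟨𝟙_ V, (λ_ A).inv, ?_⟩
  rw [kraus, dag_leftUnitor_inv]
  monoidal

lemma kraus_comp {A B C Z W : V} (g : A ⟶ C ⊗ B) (k : B ⟶ B ⊗ Z) (h : Z ⟶ W) :
    kraus g k ≫ A ◁ h = kraus g (k ≫ B ◁ h) := by
  unfold kraus
  calc _ = g ≫ C ◁ k ≫ (α_ _ _ _).inv ≫ dagger g ▷ Z ≫ A ◁ h := by simp
    _ = _ := by rw [← whisker_exchange]; monoidal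

lemma IsCP.comp {A B C : V} {f : (ᘁA : V) ⊗ A ⟶ (ᘁB : V) ⊗ B} {f' : (ᘁB : V) ⊗ B ⟶ (ᘁC : V) ⊗ C}
    (h : IsCP f) (h' : IsCP f') : IsCP (f ≫ f') := by
  rw [isCP_iff] at *
  obtain ⟨D, g, h⟩ := h
  obtain ⟨E, g', h'⟩ := h'
  refine ⟨D ⊗ E, g ≫ D ◁ g' ≫ (α_ _ _ _).inv, ?_⟩
  rw [choi_comp, h, kraus_comp, ← choi_comp, Category.id_comp, h']
  simp only [kraus, dagger_comp, dag_associator_inv, dag_whiskerLeft]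
  monoidal

end Choi

section Frobenius

open scoped MonObj

variable (V) in
/-- A dagger Frobenius algebra: a monoid satisfying the Frobenius law with respect to the comonoid
structure given by the daggers of multiplication and unit. -/
structure DaggerFrobenius where
  /-- The underlying object. -/
  X : V
  [mon : MonObj X]
  frobenius_left : X ◁ dagger μ[X] ≫ (α_ X X X).inv ≫ μ[X] ▷ X = μ[X] ≫ dagger μ[X]
  frobenius_right : dagger μ[X] ▷ X ≫ (α_ X X X).hom ≫ X ◁ μ[X] = μ[X] ≫ dagger μ[X]

attribute [instance] DaggerFrobenius.mon

namespace DaggerFrobenius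

/-- The action `A ⟶ A^* ⊗ A`, obtained by bending the left input of the multiplication. -/
def action (A : DaggerFrobenius V) : A.X ⟶ (ᘁA.X : V) ⊗ A.X :=
  (λ_ _).inv ≫ cup A.X ▷ A.X ≫ (α_ _ _ _).hom ≫ (ᘁA.X : V) ◁ μ[A.X]

/-- The coaction `A^* ⊗ A ⟶ A`. -/
def coaction (A : DaggerFrobenius V) : (ᘁA.X : V) ⊗ A.X ⟶ A.X := dagger A.action

/-- The morphism `A ⟶ 𝟙_` obtained from the multiplication by tracing out its left input. -/
def trace (A : DaggerFrobenius V) : A.X ⟶ 𝟙_ V := A.action ≫ dcap A.X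

end DaggerFrobenius

/-- A normaliser of a dagger Frobenius algebra: a central positive isomorphism `z` such that the
trace of the multiplication, precomposed with `z ∘ z`, is the counit. -/
structure Normaliser (A : DaggerFrobenius V) where
  /-- The normalising morphism. -/
  z : A.X ⟶ A.X
  isIso : IsIso z
  positive : ∃ (Y : V) (h : A.X ⟶ Y), z = h ≫ dagger h
  central_left : z ▷ A.X ≫ μ[A.X] = μ[A.X] ≫ z
  central_right : A.X ◁ z ≫ μ[A.X] = μ[A.X] ≫ z
  normalises : z ≫ z ≫ A.trace = dagger η[A.X]

namespace DaggerFrobenius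

variable (A : DaggerFrobenius V)

lemma coaction_eq : A.coaction = (ᘁA.X : V) ◁ dagger μ[A.X] ≫ (α_ _ _ _).inv ≫ dcap A.X ▷ A.X ≫
    (λ_ _).hom := by
  simp [coaction, action, dagger_comp, dag_whiskerRight, dag_whiskerLeft, dagger_associator,
    dag_leftUnitor_inv, dag_cup]

lemma choi_coaction : choi A.coaction = dagger μ[A.X] := by
  rw [coaction_eq, choi]
  calc _ = (λ_ _).inv ≫ (dcup A.X ▷ A.X ≫ (A.X ⊗ (ᘁA.X : V)) ◁ dagger μ[A.X]) ⊗≫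
        A.X ◁ dcap A.X ▷ A.X ⊗≫ 𝟙 _ := by monoidal
    _ = (λ_ _).inv ≫ (𝟙_ V) ◁ dagger μ[A.X] ⊗≫ (dcup A.X ▷ A.X ≫ (α_ _ _ _).hom ≫
        A.X ◁ dcap A.X) ▷ A.X ⊗≫ 𝟙 _ := by rw [← whisker_exchange]; monoidal
    _ = _ := by rw [snake₄]; monoidal

lemma dag_one_left : dagger μ[A.X] ≫ dagger η[A.X] ▷ A.X = (λ_ _).inv := by
  rw [← dag_whiskerRight, ← dagger_comp, MonObj.one_mul, dagger_leftUnitor]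

lemma dag_one_right : dagger μ[A.X] ≫ A.X ◁ dagger η[A.X] = (ρ_ _).inv := by
  rw [← dag_whiskerLeft, ← dagger_comp, MonObj.mul_one, dagger_rightUnitor]

lemma dag_assoc : dagger μ[A.X] ≫ A.X ◁ dagger μ[A.X] =
    dagger μ[A.X] ≫ dagger μ[A.X] ▷ A.X ≫ (α_ _ _ _).hom := by
  have h := congrArg dagger (MonObj.mul_assoc A.X)
  simp only [dagger_comp, dag_whiskerRight, dag_whiskerLeft, dagger_associator,
    Category.assoc] at h
  rw [← cancel_mono (α_ A.X A.X A.X).inv]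
  simpa using h.symm

/-- The pairing `A ⊗ A ⟶ 𝟙_`. -/
def pairing : A.X ⊗ A.X ⟶ 𝟙_ V := μ[A.X] ≫ dagger η[A.X]

lemma mul_eq_left : μ[A.X] = A.X ◁ dagger μ[A.X] ≫ (α_ _ _ _).inv ≫ A.pairing ▷ A.X ≫
    (λ_ _).hom := by
  have h := A.frobenius_left =≫ (dagger η[A.X] ▷ A.X ≫ (λ_ _).hom)
  simp only [Category.assoc, reassoc_of% (A.dag_one_left), Iso.inv_hom_id, Category.comp_id] at h
  conv_lhs => rw [← h]
  simp [pairing]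

lemma mul_eq_right : μ[A.X] = dagger μ[A.X] ▷ A.X ≫ (α_ _ _ _).hom ≫ A.X ◁ A.pairing ≫
    (ρ_ _).hom := by
  have h := A.frobenius_right =≫ (A.X ◁ dagger η[A.X] ≫ (ρ_ _).hom)
  simp only [Category.assoc, reassoc_of% (A.dag_one_right), Iso.inv_hom_id, Category.comp_id] at h
  conv_lhs => rw [← h]
  simp [pairing]

end DaggerFrobenius

lemma braid_cycle (X Y P : V) : (β_ (X ⊗ Y) P).hom ≫ (α_ P X Y).inv ≫ (β_ (P ⊗ X) Y).hom ≫
    (α_ Y P X).inv = (α_ X Y P).hom ≫ (β_ X (Y ⊗ P)).hom := by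
  have yb := BraidedCategory.yang_baxter X Y P
  rw [BraidedCategory.braiding_tensor_left_hom, BraidedCategory.braiding_tensor_left_hom,
    BraidedCategory.braiding_tensor_right_hom]
  have e : (β_ P Y).hom = (β_ Y P).inv := by
    rw [SymmetricCategory.braiding_swap_eq_inv_braiding]
  rw [e]
  calc _ = (α_ X Y P).hom ≫ (X ◁ (β_ Y P).hom ≫ (α_ X P Y).inv ≫ (β_ X P).hom ▷ Y ≫
        (α_ P X Y).hom ≫ P ◁ (β_ X Y).hom) ≫ (α_ P Y X).inv ≫ (β_ Y P).inv ▷ X := by simp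
    _ = (α_ X Y P).hom ≫ ((α_ X Y P).inv ≫ (β_ X Y).hom ▷ P ≫ (α_ Y X P).hom ≫ Y ◁ (β_ X P).hom ≫
        (α_ Y P X).inv ≫ (β_ Y P).hom ▷ X ≫ (α_ P Y X).hom) ≫ (α_ P Y X).inv ≫
        (β_ Y P).inv ▷ X := by
        congr 2
        rw [← cancel_epi (α_ X Y P).hom]
        rw [yb]
    _ = _ := by simp [← comp_whiskerRight]

/-- The trace form on `A^* ⊗ A`. -/
def traceForm (A : V) : ((ᘁA : V) ⊗ A) ⊗ ((ᘁA : V) ⊗ A) ⟶ 𝟙_ V :=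
  (α_ _ _ _).hom ≫ (ᘁA : V) ◁ ((α_ _ _ _).inv ≫ cap A ▷ A ≫ (λ_ _).hom) ≫ dcap A

lemma traceForm_symm (A : V) : (β_ _ _).hom ≫ traceForm A = traceForm A := by
  have key : traceForm A = (α_ _ _ _).hom ≫ (β_ (ᘁA : V) (A ⊗ ((ᘁA : V) ⊗ A))).hom ≫
      (α_ _ _ _).hom ≫ A ◁ (α_ _ _ _).hom ≫ (α_ _ _ _).inv ≫ (cap A ⊗ₘ cap A) ≫ (λ_ _).hom := by
    rw [traceForm, dcap_eq, BraidedCategory.braiding_naturality_right_assoc,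
      MonoidalCategory.tensorHom_def]
    monoidal
  have swap : (β_ (A ⊗ (ᘁA : V)) (A ⊗ (ᘁA : V))).hom ≫ (cap A ⊗ₘ cap A) ≫ (λ_ _).hom =
      (cap A ⊗ₘ cap A) ≫ (λ_ _).hom := by
    rw [← BraidedCategory.braiding_naturality_assoc]
    congr 1
    rw [braiding_tensorUnit_right, ← unitors_equal]; simp
  have c1 := braid_cycle (ᘁA : V) A ((ᘁA : V) ⊗ A)
  have c2 := braid_cycle (ᘁA : V) (A ⊗ (ᘁA : V)) A
  have r : (β_ ((ᘁA : V) ⊗ A) ((ᘁA : V) ⊗ A)).hom ≫ traceForm A = (β_ _ _).hom ≫ (β_ _ _).hom ≫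
      (α_ _ _ _).inv ≫ (β_ (((ᘁA : V) ⊗ A) ⊗ (ᘁA : V)) A).hom ≫ A ◁ (α_ _ _ _).hom ≫
      (α_ _ _ _).inv ≫ (β_ (A ⊗ (ᘁA : V)) (A ⊗ (ᘁA : V))).hom ≫ (cap A ⊗ₘ cap A) ≫
      (λ_ _).hom := by
    rw [key, swap, ← reassoc_of% c1]; simp
  rw [r, SymmetricCategory.symmetry_assoc]
  have n1 : (β_ (((ᘁA : V) ⊗ A) ⊗ (ᘁA : V)) A).hom ≫ A ◁ (α_ _ _ _).hom =
      (α_ _ _ _).hom ▷ A ≫ (β_ ((ᘁA : V) ⊗ (A ⊗ (ᘁA : V))) A).hom := by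
    rw [BraidedCategory.braiding_naturality_left]
  have c3 := c2 =≫ (α_ _ _ _).hom
  simp only [Category.assoc, Iso.inv_hom_id, Category.comp_id] at c3
  rw [reassoc_of% n1, reassoc_of% c3, key]
  have n2 : (β_ (ᘁA : V) ((A ⊗ (ᘁA : V)) ⊗ A)).hom = (ᘁA : V) ◁ (α_ _ _ _).hom ≫
      (β_ (ᘁA : V) (A ⊗ ((ᘁA : V) ⊗ A))).hom ≫ (α_ _ _ _).inv ▷ _ := by
    rw [← BraidedCategory.braiding_naturality_right, ← whiskerLeft_comp_assoc]; simp
  rw [n2]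
  monoidal

namespace DaggerFrobenius

variable (A : DaggerFrobenius V)

lemma mul_action : μ[A.X] ≫ A.action = (A.action ⊗ₘ A.action) ≫ (α_ _ _ _).hom ≫
    (ᘁA.X : V) ◁ ((α_ _ _ _).inv ≫ cap A.X ▷ A.X ≫ (λ_ _).hom) := by
  symm
  calc _ = (A.action ▷ A.X) ⊗≫ (ᘁA.X : V) ◁ (A.X ◁ cup A.X) ▷ A.X ⊗≫
        (ᘁA.X : V) ◁ ((A.X ⊗ (ᘁA.X : V)) ◁ μ[A.X] ≫ cap A.X ▷ A.X) ⊗≫ 𝟙 _ := by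
        rw [MonoidalCategory.tensorHom_def]
        conv_lhs => rw [show A.action = (λ_ _).inv ≫ cup A.X ▷ A.X ≫ (α_ _ _ _).hom ≫
          (ᘁA.X : V) ◁ μ[A.X] from rfl]
        conv_rhs => rw [show A.action = (λ_ _).inv ≫ cup A.X ▷ A.X ≫ (α_ _ _ _).hom ≫
          (ᘁA.X : V) ◁ μ[A.X] from rfl]
        monoidal
    _ = (A.action ▷ A.X) ⊗≫ (ᘁA.X : V) ◁ (A.X ◁ cup A.X ≫ (α_ _ _ _).inv ≫ cap A.X ▷ A.X) ▷ A.X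
        ⊗≫ (ᘁA.X : V) ◁ μ[A.X] := by
        rw [whisker_exchange]; monoidal
    _ = (A.action ▷ A.X) ⊗≫ (ᘁA.X : V) ◁ μ[A.X] := by
        rw [snake₂]; monoidal
    _ = 𝟙 _ ⊗≫ cup A.X ▷ (A.X ⊗ A.X) ⊗≫ (ᘁA.X : V) ◁ (μ[A.X] ▷ A.X ≫ μ[A.X]) := by
        unfold action; monoidal
    _ = 𝟙 _ ⊗≫ (cup A.X ▷ (A.X ⊗ A.X) ≫ ((ᘁA.X : V) ⊗ A.X) ◁ μ[A.X]) ⊗≫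
          (ᘁA.X : V) ◁ μ[A.X] := by
        rw [MonObj.mul_assoc]; monoidal
    _ = _ := by rw [← whisker_exchange]; unfold action; monoidal

lemma mul_trace : μ[A.X] ≫ A.trace = (A.action ⊗ₘ A.action) ≫ traceForm A.X := by
  rw [trace, ← Category.assoc, mul_action]; simp [traceForm]

lemma mul_trace_symm : (β_ _ _).hom ≫ μ[A.X] ≫ A.trace = μ[A.X] ≫ A.trace := by
  rw [mul_trace, ← BraidedCategory.braiding_naturality_assoc, traceForm_symm]

lemma pairing_symm (n : Normaliser A) : (β_ _ _).hom ≫ A.pairing = A.pairing := by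
  have l : A.pairing = (n.z ≫ n.z) ▷ A.X ≫ μ[A.X] ≫ A.trace := by
    rw [comp_whiskerRight, Category.assoc, reassoc_of% n.central_left, reassoc_of% n.central_left,
      n.normalises]; rfl
  have r : A.pairing = A.X ◁ (n.z ≫ n.z) ≫ μ[A.X] ≫ A.trace := by
    rw [whiskerLeft_comp, Category.assoc, reassoc_of% n.central_right,
      reassoc_of% n.central_right, n.normalises]; rfl
  conv_lhs => rw [l]
  rw [← BraidedCategory.braiding_naturality_right_assoc, mul_trace_symm, ← r]

lemma pairing_bend (h : (β_ _ _).hom ≫ A.pairing = A.pairing) :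
    cup A.X ▷ A.X ≫ (α_ _ _ _).hom ≫ (ᘁA.X : V) ◁ A.pairing ≫ (ρ_ _).hom =
      (λ_ _).hom ≫ (ρ_ _).inv ≫ A.X ◁ dcup A.X ≫ (α_ _ _ _).inv ≫ A.pairing ▷ (ᘁA.X : V) ≫
        (λ_ _).hom := by
  have n1 : A.pairing ▷ (ᘁA.X : V) ≫ (λ_ _).hom = (β_ (A.X ⊗ A.X) (ᘁA.X : V)).hom ≫
      (ᘁA.X : V) ◁ A.pairing ≫ (ρ_ _).hom := by
    rw [← BraidedCategory.braiding_naturality_left_assoc]; simp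
  symm
  calc _ = (λ_ _).hom ≫ (ρ_ _).inv ≫ A.X ◁ cup A.X ≫ (A.X ◁ ((β_ _ _).hom ≫ (β_ _ _).hom)) ≫
        (α_ _ _ _).inv ≫ (β_ _ _).hom ▷ A.X ≫ (α_ _ _ _).hom ≫
          (ᘁA.X : V) ◁ A.pairing ≫ (ρ_ _).hom := by
        rw [n1, dcup_eq, BraidedCategory.braiding_tensor_left_hom]
        simp only [whiskerLeft_comp, Category.assoc, Iso.inv_hom_id_assoc]
    _ = (λ_ _).hom ≫ (ρ_ _).inv ≫ A.X ◁ cup A.X ≫ ((α_ _ _ _).inv ≫ (β_ _ _).hom ▷ A.X ≫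
          (α_ _ _ _).hom ≫ (ᘁA.X : V) ◁ (β_ _ _).hom ≫ (α_ _ _ _).inv) ≫ (α_ _ _ _).hom ≫
          (ᘁA.X : V) ◁ A.pairing ≫ (ρ_ _).hom := by
        rw [SymmetricCategory.symmetry, whiskerLeft_id, Category.id_comp]
        conv_lhs => rw [← h]
        simp
    _ = (λ_ _).hom ≫ (ρ_ _).inv ≫ A.X ◁ cup A.X ≫ (β_ _ _).hom ≫ (α_ _ _ _).hom ≫
          (ᘁA.X : V) ◁ A.pairing ≫ (ρ_ _).hom := by
        rw [← BraidedCategory.braiding_tensor_right_hom]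
    _ = _ := by
        rw [BraidedCategory.braiding_naturality_right_assoc]; simp

lemma action_eq (h : (β_ _ _).hom ≫ A.pairing = A.pairing) : A.action = dagger μ[A.X] ≫
    ((ρ_ _).inv ≫ A.X ◁ dcup A.X ≫ (α_ _ _ _).inv ≫ A.pairing ▷ (ᘁA.X : V) ≫ (λ_ _).hom) ▷
      A.X := by
  have e := (λ_ _).inv ≫= A.pairing_bend h
  rw [Iso.inv_hom_id_assoc] at e
  rw [← e, action]
  conv_lhs => rw [mul_eq_left]
  calc _ = 𝟙 _ ⊗≫ (cup A.X ▷ A.X ≫ ((ᘁA.X : V) ⊗ A.X) ◁ dagger μ[A.X]) ⊗≫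
        (ᘁA.X : V) ◁ A.pairing ▷ A.X ⊗≫ 𝟙 _ := by monoidal
    _ = _ := by rw [← whisker_exchange]; monoidal

lemma isCP_coaction_action (n : Normaliser A) : IsCP (A.coaction ≫ A.action) := by
  rw [isCP_iff]
  refine ⟨A.X, dagger μ[A.X], ?_⟩
  rw [choi_comp, choi_coaction, A.action_eq (A.pairing_symm n), whiskerLeft_comp,
    reassoc_of% A.dag_assoc, kraus, dagger_dagger]
  have e : μ[A.X] ▷ ((ᘁA.X : V) ⊗ A.X) = (dagger μ[A.X] ▷ A.X ≫ (α_ _ _ _).hom ≫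
      A.X ◁ A.pairing ≫ (ρ_ _).hom) ▷ ((ᘁA.X : V) ⊗ A.X) := by
    conv_lhs => rw [mul_eq_right]
  rw [e]
  symm
  calc _ = dagger μ[A.X] ⊗≫ (A.X ◁ dcup A.X ≫ dagger μ[A.X] ▷ (A.X ⊗ (ᘁA.X : V))) ▷ A.X ⊗≫
        A.X ◁ A.pairing ▷ ((ᘁA.X : V) ⊗ A.X) ⊗≫ 𝟙 _ := by unfold choi; monoidal
    _ = _ := by rw [whisker_exchange]; monoidal

lemma _root_.CPStarConstruction.Normaliser.dagger_z {A : DaggerFrobenius V} (n : Normaliser A) : dagger n.z = n.z := by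
  obtain ⟨Y, h, e⟩ := n.positive
  rw [e, dagger_comp, dagger_dagger]


lemma dag_mul_z (n : Normaliser A) : n.z ≫ dagger μ[A.X] = dagger μ[A.X] ≫ n.z ▷ A.X := by
  have h := congrArg dagger n.central_left
  rw [dagger_comp, dagger_comp, dag_whiskerRight, n.dagger_z] at h
  exact h.symm

lemma dag_mul_z' (n : Normaliser A) : n.z ≫ dagger μ[A.X] = dagger μ[A.X] ≫ A.X ◁ n.z := by
  have h := congrArg dagger n.central_right
  rw [dagger_comp, dagger_comp, dag_whiskerLeft, n.dagger_z] at h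
  exact h.symm

lemma action_z (n : Normaliser A) : n.z ≫ A.action = A.action ≫ (ᘁA.X : V) ◁ n.z := by
  simp only [action, Category.assoc, ← whiskerLeft_comp, ← n.central_right]
  calc _ = (λ_ _).inv ≫ ((𝟙_ V) ◁ n.z ≫ cup A.X ▷ A.X) ⊗≫ (ᘁA.X : V) ◁ μ[A.X] := by monoidal
    _ = _ := by rw [whisker_exchange]; monoidal

lemma coaction_z (n : Normaliser A) : A.coaction ≫ n.z = (ᘁA.X : V) ◁ n.z ≫ A.coaction := by
  have h := congrArg dagger (A.action_z n)
  simpa [dagger_comp, dag_whiskerLeft, n.dagger_z, coaction] using h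

lemma action_coaction (n : Normaliser A) : n.z ≫ n.z ≫ A.action ≫ A.coaction = 𝟙 _ := by
  have e : A.action ≫ A.coaction = dagger μ[A.X] ≫ A.trace ▷ A.X ≫ (λ_ _).hom := by
    rw [coaction_eq]
    calc _ = 𝟙 _ ⊗≫ cup A.X ▷ A.X ⊗≫ (ᘁA.X : V) ◁ (μ[A.X] ≫ dagger μ[A.X]) ⊗≫
          dcap A.X ▷ A.X ⊗≫ 𝟙 _ := by unfold action; monoidal
      _ = 𝟙 _ ⊗≫ (cup A.X ▷ A.X ≫ ((ᘁA.X : V) ⊗ A.X) ◁ dagger μ[A.X]) ⊗≫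
          ((ᘁA.X : V) ◁ μ[A.X]) ▷ A.X ⊗≫ dcap A.X ▷ A.X ⊗≫ 𝟙 _ := by
          rw [← A.frobenius_left]; monoidal
      _ = _ := by rw [← whisker_exchange]; unfold trace action; monoidal
  rw [e, reassoc_of% (A.dag_mul_z n), reassoc_of% (A.dag_mul_z n),
    ← comp_whiskerRight_assoc, ← comp_whiskerRight_assoc, Category.assoc, n.normalises,
    reassoc_of% A.dag_one_left]
  simp

/-- The completely positive map given by conjugation with the normaliser. -/
lemma exists_cp (n : Normaliser A) : ∃ M : (ᘁA.X : V) ⊗ A.X ⟶ (ᘁA.X : V) ⊗ A.X,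
    IsCP M ∧ A.action ≫ M ≫ A.coaction = 𝟙 _ := by
  refine ⟨krausMap (n.z ≫ (λ_ _).inv), ⟨_, _, rfl⟩, ?_⟩
  have e : krausMap (n.z ≫ (λ_ _).inv) ≫ A.coaction = A.coaction ≫ n.z ≫ n.z := by
    apply choi_injective
    rw [choi_comp, choi_krausMap, choi_comp, kraus_comp, ← choi_comp, Category.id_comp,
      choi_coaction, kraus, dagger_comp, dag_leftUnitor_inv, n.dagger_z]
    calc _ = n.z ≫ dagger μ[A.X] ≫ n.z ▷ A.X := by monoidal
      _ = dagger μ[A.X] ≫ (A.X ◁ n.z ≫ n.z ▷ A.X) := by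
        rw [← Category.assoc, A.dag_mul_z' n, Category.assoc]
      _ = (dagger μ[A.X] ≫ n.z ▷ A.X) ≫ A.X ◁ n.z := by rw [whisker_exchange, Category.assoc]
      _ = _ := by
        rw [← A.dag_mul_z n, Category.assoc, ← A.dag_mul_z' n, A.dag_mul_z' n,
          reassoc_of% (A.dag_mul_z' n)]
        simp
  rw [e, reassoc_of% (A.coaction_z n), A.coaction_z n, ← reassoc_of% (A.action_z n),
    ← reassoc_of% (A.action_z n)]
  exact A.action_coaction n

/-- The morphisms of the CP*-construction. -/
def IsCPStar (A B : DaggerFrobenius V) (f : A.X ⟶ B.X) : Prop :=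
  IsCP (A.coaction ≫ f ≫ B.action)

lemma isCPStar_id (n : Normaliser A) : IsCPStar A A (𝟙 A.X) := by
  have := A.isCP_coaction_action n
  simpa [IsCPStar] using this

lemma IsCPStar.comp {A B C : DaggerFrobenius V} (n : Normaliser B) {f : A.X ⟶ B.X}
    {g : B.X ⟶ C.X} (hf : IsCPStar A B f) (hg : IsCPStar B C g) : IsCPStar A C (f ≫ g) := by
  obtain ⟨M, hM, e⟩ := B.exists_cp n
  have := (IsCP.comp hf hM).comp hg
  simp only [Category.assoc] at this
  rw [reassoc_of% e] at this
  simpa [IsCPStar] using this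

end DaggerFrobenius

end Frobenius

section Pants

open scoped MonObj

/-- The pair-of-pants monoid on `A^* ⊗ A`. -/
abbrev pantsMonObj (A : V) : MonObj ((ᘁA : V) ⊗ A) where
  one := cup A
  mul := (α_ _ _ _).hom ≫ (ᘁA : V) ◁ ((α_ _ _ _).inv ≫ cap A ▷ A ≫ (λ_ _).hom)
  one_mul := by
    calc _ = 𝟙 _ ⊗≫ (cup A ▷ (ᘁA : V) ≫ (α_ _ _ _).hom ≫ (ᘁA : V) ◁ cap A) ▷ A ⊗≫ 𝟙 _ := by
          monoidal
      _ = _ := by rw [snake₁]; monoidal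
  mul_one := by
    calc _ = 𝟙 _ ⊗≫ (ᘁA : V) ◁ (A ◁ cup A ≫ (α_ _ _ _).inv ≫ cap A ▷ A) ⊗≫ 𝟙 _ := by
          monoidal
      _ = _ := by rw [snake₂]; monoidal
  mul_assoc := by
    calc _ = 𝟙 _ ⊗≫ (ᘁA : V) ◁ (cap A ▷ (A ⊗ (ᘁA : V)) ≫ (𝟙_ V) ◁ cap A) ▷ A ⊗≫ 𝟙 _ := by
          monoidal
      _ = _ := by rw [← whisker_exchange]; monoidal

attribute [local instance] pantsMonObj

lemma dag_pants (A : V) : dagger ((α_ (ᘁA : V) A ((ᘁA : V) ⊗ A)).hom ≫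
    (ᘁA : V) ◁ ((α_ _ _ _).inv ≫ cap A ▷ A ≫ (λ_ _).hom)) =
      (ᘁA : V) ◁ ((λ_ _).inv ≫ dcup A ▷ A ≫ (α_ _ _ _).hom) ≫ (α_ _ _ _).inv := by
  simp [dagger_comp, dag_whiskerRight, dag_whiskerLeft, dagger_associator, dag_associator_inv,
    dagger_leftUnitor, dag_cap]

/-- The pair-of-pants dagger Frobenius algebra on `A^* ⊗ A`. -/
abbrev pants (A : V) : DaggerFrobenius V :=
  { X := (ᘁA : V) ⊗ A
    mon := pantsMonObj A
    frobenius_left := by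
      change _ ◁ dagger (_ ≫ _) ≫ _ ≫ (_ ≫ _) ▷ _ = (_ ≫ _) ≫ dagger (_ ≫ _)
      rw [dag_pants]
      calc _ = 𝟙 _ ⊗≫ (ᘁA : V) ◁ ((A ⊗ (ᘁA : V)) ◁ dcup A ≫ cap A ▷ (A ⊗ (ᘁA : V))) ▷ A ⊗≫
            𝟙 _ := by monoidal
        _ = _ := by rw [whisker_exchange]; monoidal
    frobenius_right := by
      change dagger (_ ≫ _) ▷ _ ≫ _ ≫ _ ◁ (_ ≫ _) = (_ ≫ _) ≫ dagger (_ ≫ _)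
      rw [dag_pants]
      calc _ = 𝟙 _ ⊗≫ (ᘁA : V) ◁ (dcup A ▷ (A ⊗ (ᘁA : V)) ≫ (A ⊗ (ᘁA : V)) ◁ cap A) ▷ A ⊗≫
            𝟙 _ := by monoidal
        _ = _ := by rw [← whisker_exchange]; monoidal }

lemma pants_mul (A : V) : μ[(pants A).X] = (α_ (ᘁA : V) A ((ᘁA : V) ⊗ A)).hom ≫
    (ᘁA : V) ◁ ((α_ _ _ _).inv ≫ cap A ▷ A ≫ (λ_ _).hom) := rfl

lemma pants_pairing (A : V) : (pants A).pairing = traceForm A := by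
  change (_ ≫ _) ≫ dcap A = _
  simp only [traceForm, whiskerLeft_comp, Category.assoc]

lemma isCP_pants_coaction (A : V) :
    IsCP (A := (ᘁA : V) ⊗ A) (B := A) (pants A).coaction := by
  rw [isCP_iff]
  refine ⟨(ᘁA : V), 𝟙 _, ?_⟩
  rw [DaggerFrobenius.choi_coaction, pants_mul, dag_pants, kraus, dagger_id, choi]
  simp

lemma isCP_pants_action (A : V) :
    IsCP (A := A) (B := (ᘁA : V) ⊗ A) (pants A).action := by
  rw [isCP_iff]
  refine ⟨A, choi (𝟙 _), ?_⟩
  have h : (β_ _ _).hom ≫ (pants A).pairing = (pants A).pairing := by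
    rw [pants_pairing]; exact traceForm_symm A
  rw [(pants A).action_eq h, pants_pairing, pants_mul, dag_pants, kraus]
  have e : dagger (choi (𝟙 ((ᘁA : V) ⊗ A))) = (α_ _ _ _).inv ≫ cap A ▷ A ≫ (λ_ _).hom := by
    simp [choi, dagger_comp, dag_whiskerRight, dagger_associator, dag_leftUnitor_inv, dag_dcup]
  rw [e]
  set P : V := (ᘁA : V) ⊗ A with hP
  set W : A ⟶ A ⊗ ((ᘁP : V) ⊗ P) := choi (𝟙 P) ≫ A ◁ choi (𝟙 ((ᘁP : V) ⊗ P)) ≫ (α_ _ _ _).inv ≫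
    ((α_ _ _ _).inv ≫ cap A ▷ A ≫ (λ_ _).hom) ▷ _ with hW
  calc _ = (λ_ _).inv ≫ (dcup A ▷ A ≫ (A ⊗ (ᘁA : V)) ◁ W) ⊗≫
        A ◁ dcap A ▷ ((ᘁP : V) ⊗ P) ⊗≫ 𝟙 _ := by
        rw [hW]
        unfold traceForm choi
        monoidal
    _ = (λ_ _).inv ≫ (𝟙_ V) ◁ W ⊗≫ (dcup A ▷ A ≫ (α_ _ _ _).hom ≫ A ◁ dcap A) ▷
        ((ᘁP : V) ⊗ P) ⊗≫ 𝟙 _ := by rw [← whisker_exchange]; monoidal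
    _ = W := by rw [snake₄]; monoidal

end Pants
end Basic

section Completion

/-- A category enriched over commutative monoids. -/
class CMonEnriched (C : Type u) [Category.{v} C] where
  /-- The commutative monoid structure on morphisms. -/
  addCommMonoid : ∀ X Y : C, AddCommMonoid (X ⟶ Y)
  add_comp : ∀ {X Y Z : C} (f g : X ⟶ Y) (h : Y ⟶ Z), (f + g) ≫ h = f ≫ h + g ≫ h
  comp_add : ∀ {X Y Z : C} (f : X ⟶ Y) (g h : Y ⟶ Z), f ≫ (g + h) = f ≫ g + f ≫ h
  zero_comp : ∀ {X Y Z : C} (h : Y ⟶ Z), (0 : X ⟶ Y) ≫ h = 0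
  comp_zero : ∀ {X Y Z : C} (f : X ⟶ Y), f ≫ (0 : Y ⟶ Z) = 0

attribute [reducible, instance] CMonEnriched.addCommMonoid

/-- A functor between categories enriched over commutative monoids is additive if it preserves
zero morphisms and sums of morphisms. -/
structure IsAdditiveFunctor {C : Type*} [Category* C] [CMonEnriched C] {D : Type*} [Category* D]
    [CMonEnriched D] (F : C ⥤ D) : Prop where
  map_zero : ∀ X Y : C, F.map (0 : X ⟶ Y) = 0
  map_add : ∀ {X Y : C} (f g : X ⟶ Y), F.map (f + g) = F.map f + F.map g

/-- The free biproduct completion of a category enriched over commutative monoids: the objects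
are finite families of objects, to be thought of as formal biproducts, and the morphisms are
matrices of morphisms. -/
structure BiproductCompletion (C : Type u) where
  /-- The index type. -/
  ι : Type
  [fintype : Fintype ι]
  /-- The family of objects. -/
  X : ι → C

attribute [instance] BiproductCompletion.fintype

namespace BiproductCompletion

variable {C : Type u} [Category.{v} C] [CMonEnriched C]

lemma sum_comp {ι : Type} [Fintype ι] {X Y Z : C} (f : ι → (X ⟶ Y)) (h : Y ⟶ Z) :
    (∑ i, f i) ≫ h = ∑ i, f i ≫ h :=
  let φ : (X ⟶ Y) →+ (X ⟶ Z) :=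
    { toFun := fun x => x ≫ h
      map_zero' := CMonEnriched.zero_comp h
      map_add' := fun a b => CMonEnriched.add_comp a b h }
  map_sum φ f Finset.univ

lemma comp_sum {ι : Type} [Fintype ι] {X Y Z : C} (f : X ⟶ Y) (h : ι → (Y ⟶ Z)) :
    f ≫ (∑ i, h i) = ∑ i, f ≫ h i :=
  let φ : (Y ⟶ Z) →+ (X ⟶ Z) :=
    { toFun := fun x => f ≫ x
      map_zero' := CMonEnriched.comp_zero f
      map_add' := fun a b => CMonEnriched.comp_add f a b }
  map_sum φ h Finset.univ

open scoped Classical in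
noncomputable instance : Category.{v} (BiproductCompletion C) where
  Hom M N := ∀ (i : M.ι) (j : N.ι), M.X i ⟶ N.X j
  id M i j := if h : i = j then eqToHom (congrArg M.X h) else 0
  comp f g i k := ∑ j, f i j ≫ g j k
  id_comp {M N} f := by
    funext i k
    rw [Finset.sum_eq_single i]
    · simp
    · intro j _ hj
      beta_reduce
      rw [dif_neg (Ne.symm hj), CMonEnriched.zero_comp]
    · simp
  comp_id {M N} f := by
    funext i k
    rw [Finset.sum_eq_single k]
    · simp
    · intro j _ hj
      beta_reduce
      rw [dif_neg hj, CMonEnriched.comp_zero]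
    · simp
  assoc {M N P Q} f g h := by
    funext i l
    simp only [sum_comp, comp_sum, Category.assoc]
    rw [Finset.sum_comm]

noncomputable instance : CMonEnriched (BiproductCompletion C) where
  addCommMonoid M N := inferInstanceAs (AddCommMonoid (∀ (i : M.ι) (j : N.ι), M.X i ⟶ N.X j))
  add_comp f g h := by
    funext i k
    change ∑ j, (f i j + g i j) ≫ h j k = ∑ j, f i j ≫ h j k + ∑ j, g i j ≫ h j k
    simp only [CMonEnriched.add_comp, Finset.sum_add_distrib]
  comp_add f g h := by
    funext i k
    change ∑ j, f i j ≫ (g j k + h j k) = ∑ j, f i j ≫ g j k + ∑ j, f i j ≫ h j k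
    simp only [CMonEnriched.comp_add, Finset.sum_add_distrib]
  zero_comp {M N P} h := by
    funext i k
    change ∑ j, (0 : M.X i ⟶ N.X j) ≫ h j k = 0
    simp only [CMonEnriched.zero_comp, Finset.sum_const_zero]
  comp_zero {M N P} f := by
    funext i k
    change ∑ j, f i j ≫ (0 : N.X j ⟶ P.X k) = 0
    simp only [CMonEnriched.comp_zero, Finset.sum_const_zero]

variable (C) in
/-- The canonical embedding of a category in its free biproduct completion. -/
noncomputable def inclusion : C ⥤ BiproductCompletion C where
  obj A := { ι := Unit, X := fun _ => A }
  map f := fun _ _ => f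
  map_id A := by
    funext i j
    change 𝟙 A = @dite _ (i = j) (Classical.propDecidable _) (fun h => eqToHom rfl) (fun _ => 0)
    rw [dif_pos rfl, eqToHom_refl]
  map_comp f g := by
    funext i j
    change f ≫ g = ∑ _ : Unit, f ≫ g
    simp

end BiproductCompletion

end Completion

section Biproducts

/-- A category with dagger biproducts: it has a zero object and every two objects have a biproduct
whose projections are the daggers of its injections. -/
class HasDaggerBiproducts (V : Type u) [Category.{v} V] [DaggerCategory V] [HasZeroMorphisms V] :
    Prop where
  hasZeroObject : HasZeroObject V
  exists_biproduct : ∀ A B : V, ∃ b : BinaryBicone A B,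
    Nonempty b.IsBilimit ∧ b.fst = dagger b.inl ∧ b.snd = dagger b.inr

variable {V : Type u} [Category.{v} V] [MonoidalCategory V] [SymmetricCategory V]
  [LeftRigidCategory V] [DaggerCompactCategory V] [HasZeroMorphisms V] [HasDaggerBiproducts V]

instance : HasBinaryBiproducts V where
  has_binary_biproduct A B :=
    let ⟨b, ⟨hb⟩, _⟩ := HasDaggerBiproducts.exists_biproduct A B
    HasBinaryBiproduct.mk ⟨b, hb⟩

/-- The addition of morphisms given by biproducts. -/
noncomputable instance : CMonEnriched V where
  addCommMonoid X Y := SemiadditiveOfBinaryBiproducts.addCommMonoidHomOfHasBinaryBiproducts X Y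
  add_comp := SemiadditiveOfBinaryBiproducts.add_comp
  comp_add := SemiadditiveOfBinaryBiproducts.comp_add
  zero_comp _ := Limits.zero_comp
  comp_zero _ := Limits.comp_zero

open CMonEnriched

lemma biprod_total {A B : V} (b : BinaryBicone A B) (hb : b.IsBilimit) :
    b.fst ≫ b.inl + b.snd ≫ b.inr = 𝟙 b.pt := by
  apply BinaryCofan.IsColimit.hom_ext hb.isColimit
  · change b.inl ≫ _ = b.inl ≫ _
    simp [CMonEnriched.comp_add]
  · change b.inr ≫ _ = b.inr ≫ _
    simp [CMonEnriched.comp_add]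

lemma dagger_zero (X Y : V) : dagger (0 : X ⟶ Y) = 0 := by
  obtain ⟨O, hO⟩ := (HasDaggerBiproducts.hasZeroObject (V := V)).zero
  have h : (0 : X ⟶ Y) = (0 : X ⟶ O) ≫ (0 : O ⟶ Y) := by simp
  rw [h, dagger_comp, hO.eq_of_src (dagger (0 : X ⟶ O)) 0, Limits.comp_zero]

/-- Every sum of two morphisms factors through a dagger biproduct. -/
lemma exists_factorisation {X Y : V} (f g : X ⟶ Y) : ∃ b : BinaryBicone Y Y,
    Nonempty b.IsBilimit ∧ b.fst = dagger b.inl ∧ b.snd = dagger b.inr ∧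
    ∃ (u : X ⟶ b.pt) (w : b.pt ⟶ Y), u ≫ b.fst = f ∧ u ≫ b.snd = g ∧ b.inl ≫ w = 𝟙 Y ∧
      b.inr ≫ w = 𝟙 Y ∧ f + g = u ≫ w := by
  obtain ⟨b, hb, h1, h2⟩ := HasDaggerBiproducts.exists_biproduct Y Y
  refine ⟨b, hb, h1, h2, f ≫ b.inl + g ≫ b.inr, b.fst + b.snd, ?_⟩
  simp [CMonEnriched.comp_add, CMonEnriched.add_comp]

lemma comp_eq_of_biprod {X Y A B : V} (b : BinaryBicone A B) (hb : b.IsBilimit) (u : X ⟶ b.pt)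
    (w : b.pt ⟶ Y) : u ≫ w = (u ≫ b.fst) ≫ b.inl ≫ w + (u ≫ b.snd) ≫ b.inr ≫ w := by
  have h : u ≫ (b.fst ≫ b.inl + b.snd ≫ b.inr) ≫ w = u ≫ w := by
    rw [biprod_total b hb, Category.id_comp]
  rw [← h]
  simp [CMonEnriched.comp_add, CMonEnriched.add_comp]

lemma dagger_add {X Y : V} (f g : X ⟶ Y) : dagger (f + g) = dagger f + dagger g := by
  obtain ⟨b, ⟨hb⟩, h1, h2, u, w, hf, hg, hl, hr, e⟩ := exists_factorisation f g
  rw [e, dagger_comp, comp_eq_of_biprod b hb (dagger w) (dagger u)]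
  have e1 : dagger w ≫ b.fst = 𝟙 Y := by rw [h1, ← dagger_comp, hl, dagger_id]
  have e2 : dagger w ≫ b.snd = 𝟙 Y := by rw [h2, ← dagger_comp, hr, dagger_id]
  have e3 : b.inl ≫ dagger u = dagger f := by
    rw [← hf, dagger_comp, h1, dagger_dagger]
  have e4 : b.inr ≫ dagger u = dagger g := by
    rw [← hg, dagger_comp, h2, dagger_dagger]
  rw [e1, e2, e3, e4, Category.id_comp, Category.id_comp]

lemma whiskerLeft_zero' (W X Y : V) : W ◁ (0 : X ⟶ Y) = 0 := by
  obtain ⟨O, hO⟩ := (HasDaggerBiproducts.hasZeroObject (V := V)).zero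
  have h : (0 : X ⟶ Y) = (0 : X ⟶ O) ≫ (0 : O ⟶ Y) := by simp
  have e : W ◁ (0 : O ⟶ Y) = 0 :=
    (tensorLeftHomEquiv O (ᘁW : V) W (W ⊗ Y)).injective (hO.eq_of_src _ _)
  rw [h, whiskerLeft_comp, e, Limits.comp_zero]

lemma whiskerLeft_add' (W : V) {X Y : V} (f g : X ⟶ Y) : W ◁ (f + g) = W ◁ f + W ◁ g := by
  obtain ⟨b, ⟨hb⟩, h1, h2, u, w, hf, hg, hl, hr, e⟩ := exists_factorisation f g
  have ext : ∀ {Z : V} (h h' : W ⊗ b.pt ⟶ Z), W ◁ b.inl ≫ h = W ◁ b.inl ≫ h' →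
      W ◁ b.inr ≫ h = W ◁ b.inr ≫ h' → h = h' := by
    intro Z h h' hl hr
    obtain ⟨k, rfl⟩ := (tensorLeftHomEquiv b.pt (ᘁW : V) W Z).symm.surjective h
    obtain ⟨k', rfl⟩ := (tensorLeftHomEquiv b.pt (ᘁW : V) W Z).symm.surjective h'
    congr 1
    rw [← tensorLeftHomEquiv_symm_naturality, ← tensorLeftHomEquiv_symm_naturality] at hl hr
    apply BinaryCofan.IsColimit.hom_ext hb.isColimit
    · exact (tensorLeftHomEquiv _ _ _ _).symm.injective hl
    · exact (tensorLeftHomEquiv _ _ _ _).symm.injective hr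
  have tot : W ◁ b.fst ≫ W ◁ b.inl + W ◁ b.snd ≫ W ◁ b.inr = 𝟙 _ := by
    apply ext
    · simp [CMonEnriched.comp_add, ← whiskerLeft_comp, whiskerLeft_zero']
    · simp [CMonEnriched.comp_add, ← whiskerLeft_comp, whiskerLeft_zero']
  have t : W ◁ u ≫ (W ◁ b.fst ≫ W ◁ b.inl + W ◁ b.snd ≫ W ◁ b.inr) ≫ W ◁ w = W ◁ (f + g) := by
    rw [tot, Category.id_comp, e, whiskerLeft_comp]
  rw [← t, CMonEnriched.add_comp, CMonEnriched.comp_add]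
  simp only [Category.assoc, ← whiskerLeft_comp, hl, hr, hf, hg, Category.comp_id,
    reassoc_of% hg]

lemma whiskerRight_zero' (X Y W : V) : (0 : X ⟶ Y) ▷ W = 0 := by
  have h := BraidedCategory.braiding_naturality_left (0 : X ⟶ Y) W
  rw [← cancel_mono (β_ _ _).hom, h, whiskerLeft_zero', Limits.comp_zero, Limits.zero_comp]

lemma whiskerRight_add' {X Y : V} (f g : X ⟶ Y) (W : V) : (f + g) ▷ W = f ▷ W + g ▷ W := by
  rw [← cancel_mono (β_ _ _).hom, BraidedCategory.braiding_naturality_left, whiskerLeft_add',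
    CMonEnriched.comp_add, CMonEnriched.add_comp, BraidedCategory.braiding_naturality_left,
    BraidedCategory.braiding_naturality_left]

lemma choi_zero (A Z : V) : choi (0 : (ᘁA : V) ⊗ A ⟶ Z) = 0 := by
  simp [choi, whiskerLeft_zero']

lemma choi_add {A Z : V} (f g : (ᘁA : V) ⊗ A ⟶ Z) : choi (f + g) = choi f + choi g := by
  simp [choi, whiskerLeft_add', CMonEnriched.comp_add]

lemma isCP_zero (A B : V) : IsCP (0 : (ᘁA : V) ⊗ A ⟶ (ᘁB : V) ⊗ B) := by
  rw [isCP_iff]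
  exact ⟨𝟙_ V, 0, by rw [choi_zero, kraus, Limits.zero_comp]⟩

lemma IsCP.add {A B : V} {f g : (ᘁA : V) ⊗ A ⟶ (ᘁB : V) ⊗ B} (hf : IsCP f) (hg : IsCP g) :
    IsCP (f + g) := by
  rw [isCP_iff] at *
  obtain ⟨C, p, hf⟩ := hf
  obtain ⟨D, q, hg⟩ := hg
  obtain ⟨b, ⟨hb⟩, h1, h2⟩ := HasDaggerBiproducts.exists_biproduct C D
  refine ⟨b.pt, p ≫ b.inl ▷ B + q ≫ b.inr ▷ B, ?_⟩
  rw [choi_add, hf, hg]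
  generalize choi (𝟙 ((ᘁB : V) ⊗ B)) = k
  have cross : ∀ {E E' : V} (p : A ⟶ E ⊗ B) (q : A ⟶ E' ⊗ B) (i : E ⟶ b.pt) (j : b.pt ⟶ E'),
      p ≫ i ▷ B ≫ b.pt ◁ k ≫ (α_ _ _ _).inv ≫ j ▷ B ▷ ((ᘁB : V) ⊗ B) ≫
        dagger q ▷ ((ᘁB : V) ⊗ B) = p ≫ E ◁ k ≫ (α_ _ _ _).inv ≫ (i ≫ j) ▷ B ▷ ((ᘁB : V) ⊗ B) ≫
        dagger q ▷ ((ᘁB : V) ⊗ B) := by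
    intro E E' p q i j
    rw [← whisker_exchange_assoc]
    simp
  simp only [kraus, dagger_add, dagger_comp, dag_whiskerRight, ← h1, ← h2, CMonEnriched.add_comp,
    CMonEnriched.comp_add, whiskerRight_add', comp_whiskerRight, Category.assoc, cross,
    b.inl_fst, b.inl_snd, b.inr_fst, b.inr_snd, whiskerRight_zero', id_whiskerRight,
    Category.id_comp, Limits.zero_comp, Limits.comp_zero, add_zero, zero_add]

end Biproducts

section CPM

/-- The category `CPM[V]`: the objects are those of `V`, and the morphisms `A ⟶ B` are the
completely positive morphisms `A^* ⊗ A ⟶ B^* ⊗ B`. -/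
structure CPM (V : Type u) where
  /-- The underlying object. -/
  obj : V

/-- The objects of the category `CP*[V]`: normalisable dagger Frobenius algebras, that is, dagger
Frobenius algebras together with a normaliser. -/
structure CPStar (V : Type u) [Category.{v} V] [MonoidalCategory V] [SymmetricCategory V]
    [LeftRigidCategory V] [DaggerCompactCategory V] where
  /-- The dagger Frobenius algebra. -/
  alg : DaggerFrobenius V
  /-- The normaliser. -/
  normaliser : Normaliser alg

variable {V : Type u} [Category.{v} V] [MonoidalCategory V] [SymmetricCategory V]
  [LeftRigidCategory V] [DaggerCompactCategory V]

instance : Category.{v} (CPM V) where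
  Hom A B := { f : (ᘁA.obj : V) ⊗ A.obj ⟶ (ᘁB.obj : V) ⊗ B.obj // IsCP f }
  id A := ⟨𝟙 _, isCP_id A.obj⟩
  comp f g := ⟨f.1 ≫ g.1, f.2.comp g.2⟩
  id_comp f := Subtype.ext (Category.id_comp _)
  comp_id f := Subtype.ext (Category.comp_id _)
  assoc f g h := Subtype.ext (Category.assoc _ _ _)

instance : Category.{v} (CPStar V) where
  Hom A B := { f : A.alg.X ⟶ B.alg.X // A.alg.IsCPStar B.alg f }
  id A := ⟨𝟙 _, A.alg.isCPStar_id A.normaliser⟩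
  comp {_ B _} f g := ⟨f.1 ≫ g.1, f.2.comp B.normaliser g.2⟩
  id_comp f := Subtype.ext (Category.id_comp _)
  comp_id f := Subtype.ext (Category.comp_id _)
  assoc f g h := Subtype.ext (Category.assoc _ _ _)

/-- The canonical functor `CPM[V] ⥤ CP*[V]`, defined whenever the pair-of-pants algebras
`A^* ⊗ A` carry normalisers: it sends `A` to `A^* ⊗ A`, and is the identity on morphisms. -/
def embedding (n : ∀ A : V, Normaliser (pants A)) : CPM V ⥤ CPStar V where
  obj A := { alg := pants A.obj, normaliser := n A.obj }
  map {A B} f := ⟨f.1, by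
    have h := ((isCP_pants_coaction A.obj).comp f.2).comp (isCP_pants_action B.obj)
    rw [Category.assoc] at h
    exact h⟩

variable [HasZeroMorphisms V] [HasDaggerBiproducts V]

namespace DaggerFrobenius

lemma isCPStar_zero (A B : DaggerFrobenius V) : IsCPStar A B 0 := by
  rw [IsCPStar, Limits.zero_comp, Limits.comp_zero]
  exact isCP_zero _ _

lemma IsCPStar.add {A B : DaggerFrobenius V} {f g : A.X ⟶ B.X} (hf : IsCPStar A B f)
    (hg : IsCPStar A B g) : IsCPStar A B (f + g) := by
  rw [IsCPStar, CMonEnriched.add_comp, CMonEnriched.comp_add]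
  exact IsCP.add hf hg

end DaggerFrobenius

/-- Completely positive morphisms are added as morphisms of `V`. -/
noncomputable instance : CMonEnriched (CPM V) where
  addCommMonoid A B :=
    letI : Zero (A ⟶ B) := ⟨⟨0, isCP_zero A.obj B.obj⟩⟩
    letI : Add (A ⟶ B) := ⟨fun f g => ⟨f.1 + g.1, f.2.add g.2⟩⟩
    { add := (· + ·)
      zero := 0
      add_assoc := fun f g h => Subtype.ext (add_assoc f.1 g.1 h.1)
      zero_add := fun f => Subtype.ext (zero_add f.1)
      add_zero := fun f => Subtype.ext (add_zero f.1)
      add_comm := fun f g => Subtype.ext (add_comm f.1 g.1)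
      nsmul := nsmulRec }
  add_comp f g h := Subtype.ext (CMonEnriched.add_comp f.1 g.1 h.1)
  comp_add f g h := Subtype.ext (CMonEnriched.comp_add f.1 g.1 h.1)
  zero_comp h := Subtype.ext (CMonEnriched.zero_comp h.1)
  comp_zero f := Subtype.ext (CMonEnriched.comp_zero f.1)

/-- The morphisms of `CP*[V]` are added as morphisms of `V`. -/
noncomputable instance : CMonEnriched (CPStar V) where
  addCommMonoid A B :=
    letI : Zero (A ⟶ B) := ⟨⟨0, DaggerFrobenius.isCPStar_zero A.alg B.alg⟩⟩
    letI : Add (A ⟶ B) := ⟨fun f g => ⟨f.1 + g.1, f.2.add g.2⟩⟩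
    { add := (· + ·)
      zero := 0
      add_assoc := fun f g h => Subtype.ext (add_assoc f.1 g.1 h.1)
      zero_add := fun f => Subtype.ext (zero_add f.1)
      add_zero := fun f => Subtype.ext (add_zero f.1)
      add_comm := fun f g => Subtype.ext (add_comm f.1 g.1)
      nsmul := nsmulRec }
  add_comp f g h := Subtype.ext (CMonEnriched.add_comp f.1 g.1 h.1)
  comp_add f g h := Subtype.ext (CMonEnriched.comp_add f.1 g.1 h.1)
  zero_comp h := Subtype.ext (CMonEnriched.zero_comp h.1)
  comp_zero f := Subtype.ext (CMonEnriched.comp_zero f.1)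

end CPM

end CPStarConstruction

open CPStarConstruction

/-! Two independent facts are combined.

Full faithfulness on `CPM`: the embedding does not change underlying morphisms, so only fullness
needs an argument, namely that a CP* morphism `f` between pair-of-pants algebras is completely
positive. By `exists_cp`, the identity of a normalisable algebra factors as action, a completely
positive `M`, coaction. Inserting this before and after `f` writes `f` as a composite containing
`coaction ≫ f ≫ action`, which is completely positive by hypothesis. The outer action and coaction
are completely positive because the algebras are pairs of pants (`isCP_of_isCPStar_pants`).

Extension: an additive functor into a category with finite biproducts extends to the free biproduct
completion by sending a family to a biproduct of its images and a matrix to the morphism with the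
image entries. Morphisms between biproducts are determined by their entries, and the entries can be
prescribed freely, so fullness, faithfulness and additivity pass to the extension.

It remains to find finite biproducts in `CPStar V` (`CPStar.exists_finiteBiproduct`). The dagger
biproduct in `V` of the underlying objects carries the componentwise algebra. Everything about it
rests on `ι_i(x) · y = ι_i(x · π_i(y))` and its mirror image (`inj_mul`, `mul_inj`). The diagonal of
the normalisers is a normaliser: the delicate condition is the one on traces, and cyclicity of the
partial trace gives it (`inj_trace`). Injections and projections are CP* morphisms by a module-map
criterion (`isCPStar_of_module`). -/

namespace CPStarConstruction

open DaggerCategory DaggerCompactCategory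

/-! ### Finite biproducts and matrices of morphisms between them. -/

section FiniteBiproducts

/-- A biproduct of a finite family of objects in a category enriched over commutative monoids. -/
structure FiniteBiproduct {D : Type*} [Category* D] [CMonEnriched D] {ι : Type} [Fintype ι]
    (X : ι → D) where
  /-- The underlying object. -/
  pt : D
  /-- The injections. -/
  inj : ∀ i, X i ⟶ pt
  /-- The projections. -/
  proj : ∀ i, pt ⟶ X i
  inj_proj_self : ∀ i, inj i ≫ proj i = 𝟙 (X i)
  inj_proj_ne : ∀ i j, i ≠ j → inj i ≫ proj j = 0
  total : ∑ i, proj i ≫ inj i = 𝟙 pt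

namespace FiniteBiproduct

variable {D : Type*} [Category* D] [CMonEnriched D] {ι κ : Type} [Fintype ι] [Fintype κ]
  {X : ι → D} {Y : κ → D}

attribute [simp] inj_proj_self

@[simp]
lemma inj_proj_self_assoc (P : FiniteBiproduct X) (i : ι) {Z : D} (f : X i ⟶ Z) :
    P.inj i ≫ P.proj i ≫ f = f := by
  rw [← Category.assoc, P.inj_proj_self, Category.id_comp]

lemma hom_ext_left (P : FiniteBiproduct X) {Z : D} {f g : P.pt ⟶ Z}
    (h : ∀ i, P.inj i ≫ f = P.inj i ≫ g) : f = g := by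
  rw [← Category.id_comp f, ← Category.id_comp g, ← P.total,
    BiproductCompletion.sum_comp, BiproductCompletion.sum_comp]
  simp [h]

lemma hom_ext_right (P : FiniteBiproduct X) {Z : D} {f g : Z ⟶ P.pt}
    (h : ∀ i, f ≫ P.proj i = g ≫ P.proj i) : f = g := by
  rw [← Category.comp_id f, ← Category.comp_id g, ← P.total,
    BiproductCompletion.comp_sum, BiproductCompletion.comp_sum]
  exact Finset.sum_congr rfl fun i _ => by rw [reassoc_of% h i]

/-- Injections are jointly epic and projections jointly monic, because `total` splits the identity;
this underlies all later comparisons of matrix entries. -/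
lemma hom_ext (P : FiniteBiproduct X) (Q : FiniteBiproduct Y) {f g : P.pt ⟶ Q.pt}
    (h : ∀ i j, P.inj i ≫ f ≫ Q.proj j = P.inj i ≫ g ≫ Q.proj j) : f = g :=
  P.hom_ext_left fun i => Q.hom_ext_right fun j => by simpa using h i j

lemma inj_sum (P : FiniteBiproduct X) {Z : D} (f : ∀ i, X i ⟶ Z) (i : ι) :
    P.inj i ≫ ∑ j, P.proj j ≫ f j = f i := by
  rw [BiproductCompletion.comp_sum, Finset.sum_eq_single i]
  · simp
  · intro j _ hj
    rw [← Category.assoc, P.inj_proj_ne i j hj.symm, CMonEnriched.zero_comp]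
  · simp

lemma sum_proj (P : FiniteBiproduct X) {Z : D} (f : ∀ i, Z ⟶ X i) (i : ι) :
    (∑ j, f j ≫ P.inj j) ≫ P.proj i = f i := by
  rw [BiproductCompletion.sum_comp, Finset.sum_eq_single i]
  · simp
  · intro j _ hj
    rw [Category.assoc, P.inj_proj_ne j i hj, CMonEnriched.comp_zero]
  · simp

/-- The morphism between biproducts with the given matrix. -/
noncomputable def matrix (P : FiniteBiproduct X) (Q : FiniteBiproduct Y)
    (f : ∀ i j, X i ⟶ Y j) : P.pt ⟶ Q.pt :=
  ∑ i, P.proj i ≫ ∑ j, f i j ≫ Q.inj j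

@[simp]
lemma inj_matrix_proj (P : FiniteBiproduct X) (Q : FiniteBiproduct Y) (f : ∀ i j, X i ⟶ Y j)
    (i : ι) (j : κ) : P.inj i ≫ P.matrix Q f ≫ Q.proj j = f i j := by
  rw [matrix, ← Category.assoc, inj_sum, sum_proj]

end FiniteBiproduct

end FiniteBiproducts

/-! ### Extending an additive functor to the free biproduct completion. -/

section Extension

variable {C : Type u} [Category.{v} C] [CMonEnriched C] {D : Type*} [Category* D] [CMonEnriched D]

lemma IsAdditiveFunctor.map_sum {G : C ⥤ D} (hG : IsAdditiveFunctor G) {ι : Type} [Fintype ι]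
    {X Y : C} (f : ι → (X ⟶ Y)) : G.map (∑ i, f i) = ∑ i, G.map (f i) :=
  let φ : (X ⟶ Y) →+ (G.obj X ⟶ G.obj Y) :=
    { toFun := fun x => G.map x
      map_zero' := hG.map_zero X Y
      map_add' := hG.map_add }
  _root_.map_sum φ f Finset.univ

/-- The extension of an additive functor to the free biproduct completion, defined by a choice of
biproducts. -/
noncomputable def extension {G : C ⥤ D} (hG : IsAdditiveFunctor G)
    (b : ∀ M : BiproductCompletion C, FiniteBiproduct fun i => G.obj (M.X i)) :
    BiproductCompletion C ⥤ D where
  obj M := (b M).pt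
  map {M N} f := (b M).matrix (b N) fun i j => G.map (f i j)
  map_id M := by
    apply (b M).hom_ext (b M)
    intro i j
    rw [FiniteBiproduct.inj_matrix_proj, Category.id_comp]
    -- The identity of the completion is the Kronecker delta matrix; its off-diagonal zeros are
    -- preserved because `G` is additive.
    change G.map (@dite _ (i = j) (Classical.propDecidable _)
      (fun h => eqToHom (congrArg M.X h)) (fun _ => 0)) = _
    by_cases h : i = j
    · subst h
      simp
    · rw [dif_neg h, hG.map_zero, (b M).inj_proj_ne i j h]
  map_comp {M N P} f g := by
    apply (b M).hom_ext (b P)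
    intro i k
    rw [FiniteBiproduct.inj_matrix_proj]
    change G.map (∑ j, f i j ≫ g j k) = _
    -- Splitting the identity of the middle biproduct by `total` turns the composite into the matrix
    -- product.
    rw [hG.map_sum, Category.assoc, ← Category.id_comp (((b N).matrix (b P) _) ≫ _), ← (b N).total,
      BiproductCompletion.sum_comp, BiproductCompletion.comp_sum, BiproductCompletion.comp_sum]
    refine Finset.sum_congr rfl fun j _ => ?_
    rw [G.map_comp]
    conv_lhs => rw [← (b M).inj_matrix_proj (b N) (fun i j => G.map (f i j)) i j,
      ← (b N).inj_matrix_proj (b P) (fun i j => G.map (g i j)) j k]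
    simp only [Category.assoc]

variable {G : C ⥤ D} (hG : IsAdditiveFunctor G)
  (b : ∀ M : BiproductCompletion C, FiniteBiproduct fun i => G.obj (M.X i))

lemma inj_extension_proj {M N : BiproductCompletion C} (f : M ⟶ N) (i : M.ι) (j : N.ι) :
    (b M).inj i ≫ (extension hG b).map f ≫ (b N).proj j = G.map (f i j) :=
  (b M).inj_matrix_proj (b N) _ i j

lemma extension_hom_ext {M N : BiproductCompletion C}
    {f g : (extension hG b).obj M ⟶ (extension hG b).obj N}
    (h : ∀ i j, (b M).inj i ≫ f ≫ (b N).proj j = (b M).inj i ≫ g ≫ (b N).proj j) : f = g :=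
  (b M).hom_ext (b N) h

lemma extension_additive : IsAdditiveFunctor (extension hG b) where
  map_zero M N := by
    refine extension_hom_ext hG b fun i j => (inj_extension_proj hG b _ i j).trans ?_
    refine (hG.map_zero _ _).trans ?_
    erw [CMonEnriched.zero_comp, CMonEnriched.comp_zero]
  map_add {M N} f g := by
    refine extension_hom_ext hG b fun i j => (inj_extension_proj hG b _ i j).trans ?_
    refine (hG.map_add (f i j) (g i j)).trans ?_
    rw [← inj_extension_proj hG b f, ← inj_extension_proj hG b g, ← CMonEnriched.comp_add]
    exact congrArg _ (CMonEnriched.add_comp _ _ _).symm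

/-- Each entry of a morphism between biproducts is a morphism between values of `G`, so preimages
are chosen entry by entry. -/
lemma extension_full [G.Full] : (extension hG b).Full where
  map_surjective {M N} f := by
    refine ⟨fun i j => G.preimage ((b M).inj i ≫ f ≫ (b N).proj j), ?_⟩
    refine extension_hom_ext hG b fun i j => (inj_extension_proj hG b _ i j).trans ?_
    exact G.map_preimage _

lemma extension_faithful [G.Faithful] : (extension hG b).Faithful where
  map_injective {M N} f g h := by
    funext i j
    apply G.map_injective
    rw [← inj_extension_proj hG b, h, inj_extension_proj]

/-- The extension of an additive functor agrees with it on singleton families. -/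
noncomputable def inclusionExtensionIso :
    BiproductCompletion.inclusion C ⋙ extension hG b ≅ G :=
  NatIso.ofComponents
    (fun A =>
      { hom := (b ((BiproductCompletion.inclusion C).obj A)).proj ()
        inv := (b ((BiproductCompletion.inclusion C).obj A)).inj ()
        hom_inv_id := by
          -- The chosen biproduct of a one-member family need not be the object itself, but its
          -- `total` has a single term, so projection and injection are inverse to each other.
          have h := (b ((BiproductCompletion.inclusion C).obj A)).total
          change ∑ i : Unit, _ = _ at h
          rwa [Fintype.sum_unique] at h
        inv_hom_id := (b ((BiproductCompletion.inclusion C).obj A)).inj_proj_self () })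
    fun {A B} f => by
      refine (b ((BiproductCompletion.inclusion C).obj A)).hom_ext_left fun i => ?_
      exact (inj_extension_proj hG b
        ((BiproductCompletion.inclusion C).map f) i ()).trans
        ((b ((BiproductCompletion.inclusion C).obj A)).inj_proj_self_assoc i _).symm

end Extension

/-! ### Finite dagger biproducts in `V` and their diagonal morphisms. -/

section DaggerBiproducts

variable {V : Type u} [Category.{v} V] [MonoidalCategory V] [SymmetricCategory V]
  [LeftRigidCategory V] [DaggerCompactCategory V] [HasZeroMorphisms V] [HasDaggerBiproducts V]

/-- A finite biproduct whose projections are the daggers of its injections. -/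
structure FiniteDaggerBiproduct {ι : Type} [Fintype ι] (X : ι → V) extends FiniteBiproduct X where
  proj_eq : ∀ i, proj i = dagger (inj i)

lemma dagger_sum {ι : Type} [Fintype ι] {X Y : V} (f : ι → (X ⟶ Y)) :
    dagger (∑ i, f i) = ∑ i, dagger (f i) :=
  let φ : (X ⟶ Y) →+ (Y ⟶ X) :=
    { toFun := dagger
      map_zero' := dagger_zero X Y
      map_add' := dagger_add }
  map_sum φ f Finset.univ

lemma whiskerRight_sum {ι : Type} [Fintype ι] {X Y : V} (f : ι → (X ⟶ Y)) (W : V) :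
    (∑ i, f i) ▷ W = ∑ i, f i ▷ W :=
  let φ : (X ⟶ Y) →+ (X ⊗ W ⟶ Y ⊗ W) :=
    { toFun := fun g => g ▷ W
      map_zero' := whiskerRight_zero' X Y W
      map_add' := fun g h => whiskerRight_add' g h W }
  map_sum φ f Finset.univ

lemma whiskerLeft_sum {ι : Type} [Fintype ι] {X Y : V} (W : V) (f : ι → (X ⟶ Y)) :
    W ◁ (∑ i, f i) = ∑ i, W ◁ f i :=
  let φ : (X ⟶ Y) →+ (W ⊗ X ⟶ W ⊗ Y) :=
    { toFun := fun g => W ◁ g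
      map_zero' := whiskerLeft_zero' W X Y
      map_add' := whiskerLeft_add' W }
  map_sum φ f Finset.univ

lemma exists_finiteDaggerBiproduct {ι : Type} [Fintype ι] (X : ι → V) :
    Nonempty (FiniteDaggerBiproduct X) := by
  revert X
  -- The empty family gives the zero object, and adjoining one index is a binary dagger biproduct of
  -- the new object with the biproduct already built.
  refine Fintype.induction_empty_option
    (P := fun ι _ => ∀ X : ι → V, Nonempty (FiniteDaggerBiproduct X)) ?_ ?_ ?_ ι
  · intro α β _ e ih X
    obtain ⟨Y, rfl⟩ : ∃ Y, X = Y ∘ e.symm := ⟨X ∘ e, by ext; simp⟩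
    -- The sum in `total` depends on the finiteness instance; `ih` refers to the one transported
    -- along `e`.
    let := Fintype.ofEquiv β e.symm
    obtain ⟨P⟩ := ih Y
    exact ⟨{  pt := P.pt
              inj := fun i => P.inj (e.symm i)
              proj := fun i => P.proj (e.symm i)
              inj_proj_self := fun i => P.inj_proj_self _
              inj_proj_ne := fun i j h => P.inj_proj_ne _ _ (e.symm.injective.ne h)
              total := (e.symm.sum_comp fun i => P.proj i ≫ P.inj i).trans P.total
              proj_eq := fun i => P.proj_eq _ }⟩
  · intro X
    obtain ⟨O, hO⟩ := (HasDaggerBiproducts.hasZeroObject (V := V)).zero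
    exact ⟨{  pt := O
              inj := fun i => i.elim
              proj := fun i => i.elim
              inj_proj_self := fun i => i.elim
              inj_proj_ne := fun i => i.elim
              total := hO.eq_of_src _ _
              proj_eq := fun i => i.elim }⟩
  · intro α _ ih X
    obtain ⟨P⟩ := ih fun i => X (some i)
    obtain ⟨b, ⟨hb⟩, h1, h2⟩ := HasDaggerBiproducts.exists_biproduct (X none) P.pt
    refine ⟨{ pt := b.pt
              inj := fun i => match i with
                | none => b.inl
                | some i => P.inj i ≫ b.inr
              proj := fun i => match i with
                | none => b.fst
                | some i => b.snd ≫ P.proj i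
              inj_proj_self := ?_
              inj_proj_ne := ?_
              total := ?_
              proj_eq := ?_ }⟩
    · rintro (_ | i) <;> simp
    · rintro (_ | i) (_ | j) h
      · exact absurd rfl h
      · simp
      · simp
      · have := P.inj_proj_ne i j (by simpa using h)
        simpa
    · rw [Fintype.sum_option]
      simp only [Category.assoc]
      rw [← biprod_total b hb]
      congr 1
      -- The splitting of the identity of `P.pt`, carried to the second summand of `b`, refines the
      -- term `b.snd ≫ b.inr`.
      have h := (b.snd ≫= P.total) =≫ b.inr
      rw [BiproductCompletion.comp_sum, BiproductCompletion.sum_comp] at h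
      simpa using h
    · rintro (_ | i)
      · exact h1
      · change b.snd ≫ P.proj i = dagger (P.inj i ≫ b.inr)
        rw [dagger_comp, h2, P.proj_eq]

namespace FiniteDaggerBiproduct

variable {ι : Type} [Fintype ι] {X Y : ι → V} (P : FiniteDaggerBiproduct X)
  (Q : FiniteDaggerBiproduct Y)

lemma dagger_inj (i : ι) : dagger (P.inj i) = P.proj i := (P.proj_eq i).symm

lemma dagger_proj (i : ι) : dagger (P.proj i) = P.inj i := by
  rw [P.proj_eq, dagger_dagger]

/-- Tensoring is additive, so it preserves the splitting of the identity. Identities between maps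
out of a tensor product can thus be tested on one summand of one factor. -/
lemma inj_whiskerRight_ext {W Z : V} {f g : P.pt ⊗ W ⟶ Z}
    (h : ∀ i, P.inj i ▷ W ≫ f = P.inj i ▷ W ≫ g) : f = g := by
  rw [← Category.id_comp f, ← Category.id_comp g, ← id_whiskerRight, ← P.total, whiskerRight_sum,
    BiproductCompletion.sum_comp, BiproductCompletion.sum_comp]
  simp [h]

lemma inj_whiskerLeft_ext {W Z : V} {f g : W ⊗ P.pt ⟶ Z}
    (h : ∀ i, W ◁ P.inj i ≫ f = W ◁ P.inj i ≫ g) : f = g := by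
  rw [← Category.id_comp f, ← Category.id_comp g, ← whiskerLeft_id, ← P.total, whiskerLeft_sum,
    BiproductCompletion.sum_comp, BiproductCompletion.sum_comp]
  simp [h]

/-- The diagonal morphism between biproducts. -/
noncomputable def diag (f : ∀ i, X i ⟶ Y i) : P.pt ⟶ Q.pt := ∑ i, P.proj i ≫ f i ≫ Q.inj i

lemma inj_diag (f : ∀ i, X i ⟶ Y i) (i : ι) : P.inj i ≫ P.diag Q f = f i ≫ Q.inj i :=
  P.inj_sum (fun i => f i ≫ Q.inj i) i

lemma dagger_diag (f : ∀ i, X i ⟶ Y i) :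
    dagger (P.diag Q f) = Q.diag P fun i => dagger (f i) := by
  simp only [diag, dagger_sum, dagger_comp, dagger_inj, dagger_proj, Category.assoc]

lemma diag_comp {Z : ι → V} (R : FiniteDaggerBiproduct Z) (f : ∀ i, X i ⟶ Y i)
    (g : ∀ i, Y i ⟶ Z i) : P.diag Q f ≫ Q.diag R g = P.diag R fun i => f i ≫ g i := by
  apply P.hom_ext_left
  intro i
  rw [← Category.assoc, inj_diag, Category.assoc, inj_diag, inj_diag, Category.assoc]

lemma diag_id : P.diag P (fun i => 𝟙 (X i)) = 𝟙 _ := by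
  simp [diag, P.total]

end FiniteDaggerBiproduct

end DaggerBiproducts

open scoped MonObj

/-! ### Sliding morphisms around loops, and cyclicity of the partial trace. -/

section Mates

variable {V : Type u} [Category.{v} V] [MonoidalCategory V] [SymmetricCategory V]
  [LeftRigidCategory V] [DaggerCompactCategory V]

lemma cup_whiskerLeft {X Y : V} (f : X ⟶ Y) :
    cup X ≫ (ᘁX : V) ◁ f = cup Y ≫ (ᘁf) ▷ Y :=
  (coevaluation_comp_leftAdjointMate f).symm

/-- The sliding rule for the chosen counit transfers to the dagger of the unit, since the two differ
by the symmetry. -/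
lemma mate_whiskerRight_dcap {X Y : V} (f : X ⟶ Y) :
    (ᘁf) ▷ X ≫ dcap X = (ᘁY : V) ◁ f ≫ dcap Y := by
  have h : X ◁ (ᘁf) ≫ cap X = f ▷ _ ≫ cap Y := leftAdjointMate_comp_evaluation f
  rw [dcap_eq, dcap_eq, BraidedCategory.braiding_naturality_left_assoc, h,
    BraidedCategory.braiding_naturality_right_assoc]

/-- The partial trace over the left tensor factor. -/
def leftTrace {X Y : V} (h : X ⊗ Y ⟶ X) : Y ⟶ 𝟙_ V :=
  (λ_ _).inv ≫ cup X ▷ Y ≫ (α_ _ _ _).hom ≫ (ᘁX : V) ◁ h ≫ dcap X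

/-- The morphism `a` is slid around the loop: over the cup it becomes its mate, which passes `h` by
interchange and returns to `a` at the other end. -/
lemma leftTrace_cyclic {X X' Y : V} (a : X ⟶ X') (h : X' ⊗ Y ⟶ X) :
    leftTrace (a ▷ Y ≫ h) = leftTrace (h ≫ a) := by
  calc _ = (λ_ _).inv ≫ (cup X ≫ (ᘁX : V) ◁ a) ▷ Y ≫ (α_ _ _ _).hom ≫ (ᘁX : V) ◁ h ≫
        dcap X := by unfold leftTrace; monoidal
    _ = (λ_ _).inv ≫ cup X' ▷ Y ≫ (α_ _ _ _).hom ≫ ((ᘁa) ▷ (X' ⊗ Y) ≫ (ᘁX : V) ◁ h) ≫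
        dcap X := by rw [cup_whiskerLeft]; monoidal
    _ = _ := by
      rw [← whisker_exchange, Category.assoc, mate_whiskerRight_dcap, leftTrace]
      simp

lemma comp_leftTrace {X Y Z : V} (a : Z ⟶ Y) (h : X ⊗ Y ⟶ X) :
    a ≫ leftTrace h = leftTrace (X ◁ a ≫ h) := by
  calc _ = (λ_ _).inv ≫ ((𝟙_ V) ◁ a ≫ cup X ▷ Y) ≫ (α_ _ _ _).hom ≫ (ᘁX : V) ◁ h ≫
        dcap X := by unfold leftTrace; monoidal
    _ = _ := by rw [whisker_exchange]; unfold leftTrace; monoidal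

lemma DaggerFrobenius.trace_eq (A : DaggerFrobenius V) : A.trace = leftTrace μ[A.X] := by
  simp [trace, action, leftTrace]

end Mates

/-! ### A criterion for CP* morphisms, and full faithfulness of the embedding. -/

section CPStarMorphisms

variable {V : Type u} [Category.{v} V] [MonoidalCategory V] [SymmetricCategory V]
  [LeftRigidCategory V] [DaggerCompactCategory V]

/-- The hypothesis reads `f†(f(a) · b) = a · f†(b)`: `f†` is a map of left `A`-modules when `A` acts
on `B` through `f`. Then `f_* ⊗ f`, which is completely positive, intertwines the two coactions with
`f`, and the rest is the completely positive `coaction ≫ action` of `B`. -/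
lemma DaggerFrobenius.isCPStar_of_module {A B : DaggerFrobenius V} (n : Normaliser B)
    (f : A.X ⟶ B.X) (h : f ▷ B.X ≫ μ[B.X] ≫ dagger f = A.X ◁ dagger f ≫ μ[A.X]) :
    IsCPStar A B f := by
  -- The ancilla is the tensor unit, so the Kraus map is `f_* ⊗ f`. After bending a wire with
  -- `choi`, the claim is the dagger of `h`.
  have e : krausMap (f ≫ (λ_ _).inv) ≫ B.coaction = A.coaction ≫ f := by
    apply choi_injective
    rw [choi_comp, choi_krausMap, choi_comp, kraus_comp, ← choi_comp, Category.id_comp,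
      choi_coaction, choi_coaction, kraus, dagger_comp, dag_leftUnitor_inv]
    have h' := congrArg dagger h
    simp only [dagger_comp, dag_whiskerRight, dag_whiskerLeft, dagger_dagger,
      Category.assoc] at h'
    rw [← h']
    monoidal
  rw [IsCPStar, ← reassoc_of% e]
  exact IsCP.comp ⟨_, _, rfl⟩ (B.isCP_coaction_action n)

/-- With `M` and `N` from `exists_cp`, `f` equals `(action ≫ M ≫ coaction) ≫ f ≫ (action ≫ N ≫
coaction)`. Rebracketed around `coaction ≫ f ≫ action`, this is a composite of completely positive
morphisms. -/
lemma isCP_of_isCPStar_pants {A B : V} (m : Normaliser (pants A)) (n : Normaliser (pants B))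
    {f : (pants A).X ⟶ (pants B).X} (hf : DaggerFrobenius.IsCPStar (pants A) (pants B) f) :
    IsCP (A := A) (B := B) f := by
  obtain ⟨M, hM, e⟩ := (pants A).exists_cp m
  obtain ⟨N, hN, e'⟩ := (pants B).exists_cp n
  have h := (((isCP_pants_action A).comp hM).comp (IsCP.comp hf hN)).comp (isCP_pants_coaction B)
  simp only [Category.assoc] at h
  rwa [e', Category.comp_id, reassoc_of% e] at h

lemma embedding_full (n : ∀ A : V, Normaliser (pants A)) : (embedding n).Full where
  map_surjective {A B} f := ⟨⟨f.1, isCP_of_isCPStar_pants (n A.obj) (n B.obj) f.2⟩, rfl⟩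

lemma embedding_faithful (n : ∀ A : V, Normaliser (pants A)) : (embedding n).Faithful where
  map_injective {A B} _ _ h := Subtype.ext
    (congrArg (fun k : (embedding n).obj A ⟶ (embedding n).obj B => k.1) h)

end CPStarMorphisms

/-! ### Biproducts of normalisable dagger Frobenius algebras, and biproducts in `CPStar V`. -/

section BiproductAlgebra

variable {V : Type u} [Category.{v} V] [MonoidalCategory V] [SymmetricCategory V]
  [LeftRigidCategory V] [DaggerCompactCategory V] [HasZeroMorphisms V] [HasDaggerBiproducts V]

namespace FiniteDaggerBiproduct

variable {J : Type} [Fintype J] {A : J → DaggerFrobenius V}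
  (P : FiniteDaggerBiproduct fun i => (A i).X)

/-- The componentwise multiplication on a biproduct of algebras. -/
noncomputable def mul : P.pt ⊗ P.pt ⟶ P.pt :=
  ∑ i, ((P.proj i ⊗ₘ P.proj i) ≫ μ[(A i).X]) ≫ P.inj i

/-- The componentwise unit on a biproduct of algebras. -/
noncomputable def one : 𝟙_ V ⟶ P.pt := ∑ i, η[(A i).X] ≫ P.inj i

lemma mul_proj (i : J) : P.mul ≫ P.proj i = (P.proj i ⊗ₘ P.proj i) ≫ μ[(A i).X] :=
  P.sum_proj (fun i => (P.proj i ⊗ₘ P.proj i) ≫ μ[(A i).X]) i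

lemma one_proj (i : J) : P.one ≫ P.proj i = η[(A i).X] :=
  P.sum_proj (fun i => η[(A i).X]) i

/-- Products of elements from different summands vanish, so multiplying by something in summand `i`
sees only the `i`-th component of the other factor. -/
lemma inj_mul (i : J) : P.inj i ▷ P.pt ≫ P.mul = (A i).X ◁ P.proj i ≫ μ[(A i).X] ≫ P.inj i := by
  apply P.hom_ext_right
  intro j
  rw [Category.assoc, mul_proj, Category.assoc, Category.assoc, MonoidalCategory.tensorHom_def,
    Category.assoc, ← comp_whiskerRight_assoc]
  by_cases h : i = j
  · subst h
    simp
  · rw [P.inj_proj_ne i j h]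
    erw [CMonEnriched.comp_zero, whiskerRight_zero']
    simp

lemma mul_inj (i : J) : P.pt ◁ P.inj i ≫ P.mul = P.proj i ▷ (A i).X ≫ μ[(A i).X] ≫ P.inj i := by
  apply P.hom_ext_right
  intro j
  rw [Category.assoc, mul_proj, Category.assoc, Category.assoc, MonoidalCategory.tensorHom_def',
    Category.assoc, ← whiskerLeft_comp_assoc]
  by_cases h : i = j
  · subst h
    simp
  · rw [P.inj_proj_ne i j h]
    erw [CMonEnriched.comp_zero, whiskerLeft_zero']
    simp

/-- The dagger of `inj_mul`: once one leg of the comultiplication is projected to summand `i`, only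
the comultiplication of `A i` contributes. -/
lemma dagger_mul_proj_left (i : J) :
    dagger P.mul ≫ P.proj i ▷ P.pt = P.proj i ≫ dagger μ[(A i).X] ≫ (A i).X ◁ P.inj i := by
  have h := congrArg dagger (P.inj_mul i)
  simpa only [dagger_comp, dag_whiskerRight, dag_whiskerLeft, dagger_inj, dagger_proj,
    Category.assoc] using h

lemma dagger_mul_proj_right (i : J) :
    dagger P.mul ≫ P.pt ◁ P.proj i = P.proj i ≫ dagger μ[(A i).X] ≫ P.inj i ▷ (A i).X := by
  have h := congrArg dagger (P.mul_inj i)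
  simpa only [dagger_comp, dag_whiskerRight, dag_whiskerLeft, dagger_inj, dagger_proj,
    Category.assoc] using h

lemma inj_dagger_mul (i : J) :
    P.inj i ≫ dagger P.mul = dagger μ[(A i).X] ≫ (P.inj i ⊗ₘ P.inj i) := by
  have h := congrArg dagger (P.mul_proj i)
  simpa only [dagger_comp, dagger_tensor, dagger_inj, dagger_proj] using h

lemma inj_dagger_one (i : J) : P.inj i ≫ dagger P.one = dagger η[(A i).X] := by
  have h := congrArg dagger (P.one_proj i)
  simpa only [dagger_comp, dagger_proj] using h

/-- The componentwise monoid structure on a biproduct of algebras. -/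
noncomputable abbrev monObj : MonObj P.pt where
  one := P.one
  mul := P.mul
  one_mul := by
    -- Projections are jointly monic and compatible with unit and multiplication, so each monoid law
    -- reduces to the same law in every `A i`.
    apply P.hom_ext_right
    intro i
    rw [Category.assoc, mul_proj, MonoidalCategory.tensorHom_def, Category.assoc,
      ← comp_whiskerRight_assoc, one_proj, ← whisker_exchange_assoc, MonObj.one_mul]
    simp
  mul_one := by
    apply P.hom_ext_right
    intro i
    rw [Category.assoc, mul_proj, MonoidalCategory.tensorHom_def', Category.assoc,
      ← whiskerLeft_comp_assoc, one_proj, whisker_exchange_assoc, MonObj.mul_one]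
    simp
  mul_assoc := by
    apply P.hom_ext_right
    intro i
    simp only [Category.assoc, mul_proj]
    rw [← tensorHom_id, ← id_tensorHom, tensorHom_comp_tensorHom_assoc, mul_proj,
      tensorHom_comp_tensorHom_assoc, mul_proj]
    have l : ((P.proj i ⊗ₘ P.proj i) ≫ μ[(A i).X] ⊗ₘ 𝟙 P.pt ≫ P.proj i) =
        ((P.proj i ⊗ₘ P.proj i) ⊗ₘ P.proj i) ≫ μ[(A i).X] ▷ _ := by
      rw [← tensorHom_id, tensorHom_comp_tensorHom, Category.id_comp, Category.comp_id]
    have r : (𝟙 P.pt ≫ P.proj i ⊗ₘ (P.proj i ⊗ₘ P.proj i) ≫ μ[(A i).X]) =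
        (P.proj i ⊗ₘ (P.proj i ⊗ₘ P.proj i)) ≫ _ ◁ μ[(A i).X] := by
      rw [← id_tensorHom, tensorHom_comp_tensorHom, Category.id_comp, Category.comp_id]
    rw [l, r, Category.assoc, Category.assoc, MonObj.mul_assoc]
    simp

/-- The componentwise dagger Frobenius algebra structure on a biproduct of algebras. -/
noncomputable abbrev algebra : DaggerFrobenius V :=
  { X := P.pt
    mon := P.monObj
    frobenius_left := by
      change P.pt ◁ dagger P.mul ≫ (α_ _ _ _).inv ≫ P.mul ▷ P.pt = P.mul ≫ dagger P.mul
      -- With the left input restricted to summand `i`, both sides become the Frobenius law of `A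
      -- i`, with its right input projected to and its outputs injected from that summand.
      apply P.inj_whiskerRight_ext
      intro i
      rw [reassoc_of% (P.inj_mul i), inj_dagger_mul, ← reassoc_of% (A i).frobenius_left]
      calc _ = (P.inj i ▷ P.pt ≫ P.pt ◁ dagger P.mul) ≫ (α_ _ _ _).inv ≫ P.mul ▷ P.pt := by simp
        _ = (A i).X ◁ dagger P.mul ≫ (α_ _ _ _).inv ≫ (P.inj i ▷ P.pt ≫ P.mul) ▷ P.pt := by
          rw [← whisker_exchange]; simp
        _ = (A i).X ◁ (dagger P.mul ≫ P.proj i ▷ P.pt) ≫ (α_ _ _ _).inv ≫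
            (μ[(A i).X] ≫ P.inj i) ▷ P.pt := by
          rw [inj_mul]; simp
        _ = _ := by
          rw [dagger_mul_proj_left]
          simp only [MonoidalCategory.tensorHom_def', ← whisker_exchange_assoc]
          simp
    frobenius_right := by
      change dagger P.mul ▷ P.pt ≫ (α_ _ _ _).hom ≫ P.pt ◁ P.mul = P.mul ≫ dagger P.mul
      apply P.inj_whiskerLeft_ext
      intro i
      rw [reassoc_of% (P.mul_inj i), inj_dagger_mul, ← reassoc_of% (A i).frobenius_right]
      calc _ = dagger P.mul ▷ (A i).X ≫ (α_ _ _ _).hom ≫ P.pt ◁ (P.pt ◁ P.inj i ≫ P.mul) := by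
            rw [whisker_exchange_assoc]; simp
        _ = (dagger P.mul ≫ P.pt ◁ P.proj i) ▷ (A i).X ≫ (α_ _ _ _).hom ≫
            P.pt ◁ (μ[(A i).X] ≫ P.inj i) := by
          rw [mul_inj]; simp
        _ = _ := by
          rw [dagger_mul_proj_right]
          simp only [MonoidalCategory.tensorHom_def, whisker_exchange_assoc]
          simp }

/-- With its right input in summand `i`, the multiplication factors through `P.proj i` and `P.inj i`
on the traced wire; by cyclicity these meet and cancel, leaving the trace of `A i`. -/
lemma inj_trace (i : J) : P.inj i ≫ P.algebra.trace = (A i).trace := by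
  rw [DaggerFrobenius.trace_eq, DaggerFrobenius.trace_eq]
  change _ ≫ leftTrace P.mul = _
  rw [comp_leftTrace, mul_inj, leftTrace_cyclic, Category.assoc, P.inj_proj_self]
  simp

/-- A biproduct of normalisable algebras is normalisable, by the componentwise normaliser. -/
lemma exists_normaliser (n : ∀ i, Normaliser (A i)) : Nonempty (Normaliser P.algebra) := by
  -- The positivity witnesses have varying codomains `Y i`, so the diagonal witness lands in a
  -- second dagger biproduct `Q`.
  choose Y h hz using fun i => (n i).positive
  obtain ⟨Q⟩ := exists_finiteDaggerBiproduct Y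
  have hi := fun i => (n i).isIso
  refine ⟨{ z := P.diag P fun i => (n i).z
            isIso := ⟨P.diag P fun i => inv (n i).z, ?_, ?_⟩
            positive := ⟨Q.pt, P.diag Q h, ?_⟩
            central_left := ?_
            central_right := ?_
            normalises := ?_ }⟩
  · simp [diag_comp, diag_id]
  · simp [diag_comp, diag_id]
  · rw [dagger_diag, diag_comp]
    exact congrArg _ (funext hz)
  · change _ ▷ P.pt ≫ P.mul = P.mul ≫ _
    apply P.inj_whiskerRight_ext
    intro i
    rw [← comp_whiskerRight_assoc, inj_diag, ← Category.assoc, inj_mul, comp_whiskerRight,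
      Category.assoc, inj_mul, Category.assoc, Category.assoc, inj_diag,
      ← reassoc_of% (n i).central_left, whisker_exchange_assoc]
  · change P.pt ◁ _ ≫ P.mul = P.mul ≫ _
    apply P.inj_whiskerLeft_ext
    intro i
    rw [← whiskerLeft_comp_assoc, inj_diag, ← Category.assoc (P.pt ◁ P.inj i), mul_inj,
      whiskerLeft_comp, Category.assoc, mul_inj, Category.assoc, Category.assoc, inj_diag,
      ← reassoc_of% (n i).central_right, whisker_exchange_assoc]
  · change _ = dagger P.one
    -- Trace and counit both restrict along `P.inj i` to those of `A i`, where the condition is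
    -- known.
    apply P.hom_ext_left
    intro i
    rw [inj_dagger_one, ← (n i).normalises, ← Category.assoc, inj_diag, Category.assoc,
      ← Category.assoc (P.inj i), inj_diag, Category.assoc, inj_trace]

/-- The module condition here is `π_i(ι_i(a) · b) = a · π_i(b)`, from `inj_mul`; for `isCPStar_proj`
it is `ι_i(π_i(a) · b) = a · ι_i(b)`, which is `mul_inj`. -/
lemma isCPStar_inj (n : Normaliser P.algebra) (i : J) :
    DaggerFrobenius.IsCPStar (A i) P.algebra (P.inj i) := by
  apply DaggerFrobenius.isCPStar_of_module n
  change P.inj i ▷ P.pt ≫ P.mul ≫ dagger (P.inj i) = _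
  rw [← Category.assoc, inj_mul, dagger_inj]
  simp

lemma isCPStar_proj (n : ∀ i, Normaliser (A i)) (i : J) :
    DaggerFrobenius.IsCPStar P.algebra (A i) (P.proj i) := by
  apply DaggerFrobenius.isCPStar_of_module (n i)
  change _ = P.pt ◁ dagger (P.proj i) ≫ P.mul
  rw [dagger_proj, mul_inj]

end FiniteDaggerBiproduct

lemma CPStar.val_sum {A B : CPStar V} {J : Type} [Fintype J] (f : J → (A ⟶ B)) :
    (∑ i, f i).1 = ∑ i, (f i).1 :=
  let φ : (A ⟶ B) →+ (A.alg.X ⟶ B.alg.X) :=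
    { toFun := Subtype.val
      map_zero' := rfl
      map_add' := fun _ _ => rfl }
  map_sum φ f Finset.univ

/-- Composition and sums are those of `V`, so the biproduct equations are inherited; what matters is
that the object is normalisable and the structure maps are CP*. -/
lemma CPStar.exists_finiteBiproduct {J : Type} [Fintype J] (A : J → CPStar V) :
    Nonempty (FiniteBiproduct A) := by
  obtain ⟨P⟩ := exists_finiteDaggerBiproduct fun i => (A i).alg.X
  obtain ⟨n⟩ := P.exists_normaliser fun i => (A i).normaliser
  exact ⟨{  pt := ⟨P.algebra, n⟩
            inj := fun i => ⟨P.inj i, P.isCPStar_inj n i⟩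
            proj := fun i => ⟨P.proj i, P.isCPStar_proj (fun i => (A i).normaliser) i⟩
            inj_proj_self := fun i => Subtype.ext (P.inj_proj_self i)
            inj_proj_ne := fun i j h => Subtype.ext (P.inj_proj_ne i j h)
            total := Subtype.ext ((CPStar.val_sum _).trans P.total) }⟩

lemma embedding_additive (n : ∀ A : V, Normaliser (pants A)) : IsAdditiveFunctor (embedding n) where
  map_zero _ _ := rfl
  map_add _ _ := rfl

end BiproductAlgebra

end CPStarConstruction

open CPStarConstruction
theorem mainTheorem5 {V : Type u} [Category.{v} V] [MonoidalCategory V] [SymmetricCategory V]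
    [LeftRigidCategory V] [DaggerCompactCategory V] [HasZeroMorphisms V]
    [HasDaggerBiproducts V] (n : ∀ A : V, Normaliser (pants A)) :
    (embedding n).Full ∧ (embedding n).Faithful ∧
    ∃ F : BiproductCompletion (CPM V) ⥤ CPStar V,
      F.Full ∧ F.Faithful ∧ IsAdditiveFunctor F ∧
      Nonempty (BiproductCompletion.inclusion (CPM V) ⋙ F ≅ embedding n) := by
  have hfull := embedding_full n
  have hfaith := embedding_faithful n
  have hadd := embedding_additive n
  -- Any choice of biproducts works: different choices give isomorphic extensions.
  let b := fun M : BiproductCompletion (CPM V) =>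
    (CPStar.exists_finiteBiproduct fun i => (embedding n).obj (M.X i)).some
  exact ⟨hfull, hfaith, extension hadd b, extension_full hadd b, extension_faithful hadd b,
    extension_additive hadd b, ⟨inclusionExtensionIso hadd b⟩⟩
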